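/- **Types.** Fix countably infinite sets of datatype variables $\alpha,\beta,\dots$, of type variables $X,Y,\dots$ (jointly written $V,W$), and of constants $c$; each constant is both a term constant and a type constant. *Datatypes* $D$ and *types* $A$ are given by $$D ::= \alpha \mid c \mid D\mathbin{@}A \mid D\oplus D \mid \mu\alpha.D,\qquad A ::= X \mid D \mid A\supset A \mid A\oplus A \mid \mu X.A,$$ where in $\mu X.A$ the body $A$ is not a datatype (a recursive type whose body is a datatype is written $\mu\alpha.D$). Expressions are identified up to renaming of bound variables. Moreover every subexpression $\mu V.A$ must be *contractive*: $V$ occurs in $A$ only under $\supset$ or $@$, if at all. The set of these is $\mathcal T$; all types below are in $\mathcal T$. For $n\ge 1$, $\bigoplus_{i\in 1..n}A_i$ is $(\dots(A_1\oplus A_2)\oplus\dots)\oplus A_n$. We write $A\ne\oplus$ if the root symbol of $A$ is not $\oplus$. *Equivalence* $\simeq_\mu$ is the least equivalence relation on $\mathcal T$ that is a congruence for $@$, $\supset$, $\oplus$ and $\mu$ (for $\mu$: $A\simeq_\mu B$ implies $\mu V.A\simeq_\mu\mu V.B$), satisfies $A\oplus A\simeq_\mu A$, $A\oplus B\simeq_\mu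 B\oplus A$, $A\oplus(B\oplus C)\simeq_\mu(A\oplus B)\oplus C$ and $\mu V.A\simeq_\mu A\{\mu V.A/V\}$, and is closed under: if $\mu V.B$ is contractive and $A\simeq_\mu B\{A/V\}$ (with $A$ a datatype if $V$ is a datatype variable), then $A\simeq_\mu\mu V.B$. *Subtyping* $\Sigma\vdash A\preceq_\mu B$, for a finite set $\Sigma$ of assumptions $V\preceq_\mu W$ between variables, is defined inductively: it is reflexive and transitive; contains $V\preceq_\mu W$ when this is in $\Sigma$; contains $\simeq_\mu$; if $D\preceq_\mu D'$ and $A\preceq_\mu A'$ then $D\mathbin @A\preceq_\mu D'\mathbin @A'$; if $A\preceq_\mu A'$ and $B\preceq_\mu B'$ then $A'\supset B\preceq_\mu A\supset B'$; if $A\preceq_\mu C$ and $B\preceq_\mu C$ then $A\oplus B\preceq_\mu C$; if $A\preceq_\mu B$ or $A\preceq_\mu C$ then $A\preceq_\mu B\oplus C$ (all under the same $\Sigma$); and if $\Sigma,V\preceq_\mu W\vdash A\preceq_\mu B$ with $W\notin\mathrm{fv}(A)$, $V\notin\mathrm{fv}(B)$ and $V,W$ not occurring in $\Sigma$, then $\Sigma\vdash\mu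 V.A\preceq_\mu\mu W.B$. Write $A\preceq_\mu B$ when $\Sigma=\varnothing$. **Patterns and terms.** Patterns are $p ::= x\mid c\mid p\,p$, with no variable (matchable) occurring twice in a pattern; $\mathrm{fm}(p)$ is the set of matchables of $p$. Terms are $t ::= x\mid c\mid t\,t\mid (p_1\to_{\theta_1}t_1\mid\dots\mid p_n\to_{\theta_n}t_n)$ with $n\ge 1$, where the matchables of $p_i$ are bound in $t_i$. Contexts $\Gamma,\theta$ are partial functions from term variables to $\mathcal T$; in $\Gamma,\theta$ the assignments of $\theta$ shadow those of $\Gamma$. Pattern typing: $\theta\vdash_p x:A$ if $\theta(x)=A$; $\theta\vdash_p c:c$; and $\theta\vdash_p p\,q:D\mathbin @A$ if $\theta\vdash_p p:D$ with $D$ a datatype and $\theta\vdash_p q:A$. **Compatibility.** A position is a word over $\{1,2\}$; $\mathrm{pos}(p)$ is the set of positions of $p$ and $p|_\pi$ the subpattern of $p$ at $\pi$. A pattern $p$ *subsumes* $q$ if $\sigma p=q$ for some substitution $\sigma$ of patterns for matchables. Let $\mathrm{cpos}(p,q)$ be the set of those $\pi\in\mathrm{pos}(p)\cap\mathrm{pos}(q)$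 that have no proper extension in $\mathrm{pos}(p)\cap\mathrm{pos}(q)$ and for which $p|_\pi$ does not subsume $q|_\pi$. The set $A\|_\pi$ of symbols admitted by $A$ at $\pi$ is given by $a\|_\epsilon=\{a\}$ for a variable or constant $a$; $(A_1\star A_2)\|_\epsilon=\{\star\}$ and $(A_1\star A_2)\|_{i\pi}=A_i\|_\pi$ for $\star\in\{\supset,@\}$; $(A_1\oplus A_2)\|_\pi=A_1\|_\pi\cup A_2\|_\pi$; $(\mu V.A)\|_\pi=(A\{\mu V.A/V\})\|_\pi$. A list $[p_i:A_i]_{i\in1..n}$ is *compatible* if for all $i<j$: whenever $A_i\|_\pi\cap A_j\|_\pi\ne\varnothing$ for every $\pi\in\mathrm{cpos}(p_i,p_j)$, then $A_j\preceq_\mu A_i$. **Original typing** $\Gamma\vdash s:A$: - $\Gamma\vdash x:A$ if $\Gamma(x)=A$; $\Gamma\vdash c:c$; $\Gamma\vdash r\,u:D\mathbin @A$ if $\Gamma\vdash r:D$ with $D$ a datatype and $\Gamma\vdash u:A$; - (t-abs) $\Gamma\vdash(p_i\to_{\theta_i}s_i)_{i\in1..n}:(\bigoplus_{i\in 1..n}A_i)\supset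 B$ if $[p_i:A_i]_{i\in 1..n}$ is compatible and, for all $i$, $\theta_i\vdash_p p_i:A_i$, $\mathrm{dom}(\theta_i)=\mathrm{fm}(p_i)$ and $\Gamma,\theta_i\vdash s_i:B$; - (t-app) $\Gamma\vdash r\,u:B$ if $\Gamma\vdash r:(\bigoplus_{i\in 1..n}A_i)\supset B$ and $\Gamma\vdash u:A_k$ for some $k\in 1..n$; - (t-subs) $\Gamma\vdash s:A'$ if $\Gamma\vdash s:A$ and $A\preceq_\mu A'$. **Syntax-directed typing** $\Gamma\vdash_{sd}s:A$: the rules for variables, constants and compounds as above (with $\vdash_{sd}$), no subsumption, and - (t-abs-al) $\Gamma\vdash_{sd}(p_i\to_{\theta_i}s_i)_{i\in1..n}:(\bigoplus_{i\in 1..n}A_i)\supset(\bigoplus_{i\in 1..n}B_i)$ if $[p_i:A_i]_{i\in 1..n}$ is compatible and, for all $i$, $\theta_i\vdash_p p_i:A_i$, $\mathrm{dom}(\theta_i)=\mathrm{fm}(p_i)$ and $\Gamma,\theta_i\vdash_{sd}s_i:B_i$; - (t-app-al) $\Gamma\vdash_{sd}r\,u:\bigoplus_{i\in 1..n}B_i$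 if $\Gamma\vdash_{sd}r:A$, $A\simeq_\mu\bigoplus_{i\in 1..n}(A_i\supset B_i)$ with every $A_i\neq\oplus$, $\Gamma\vdash_{sd}u:C$, and $C\preceq_\mu A_i$ for all $i\in 1..n$. **Proposition.** For every context $\Gamma$, term $s$ and type $A\in\mathcal T$: 1. if $\Gamma\vdash_{sd}s:A$, then $\Gamma\vdash s:A$; 2. if $\Gamma\vdash s:A$, then there is $A'\in\mathcal T$ with $A'\preceq_\mu A$ and $\Gamma\vdash_{sd}s:A'$. -/

import Mathlib

namespace CAP

/-! ### Contractive recursive types -/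

/-- The two sorts of type variables (and of recursive binders): datatype variables
`α, β, …` and general type variables `X, Y, …`. -/
inductive VSort where
  | data
  | type
  deriving DecidableEq

/-- Type variables: countably many of each sort. -/
structure TVar where
  sort : VSort
  idx : ℕ
  deriving DecidableEq

/-- Raw type expressions up to renaming of bound variables, in locally nameless style.
`bvar k i` is the variable bound by the `i`-th enclosing binder *of sort `k`*
(counting from the inside, from `0`); `fvar V` is a free variable;
`app D A` is the compound `D @ A`; `fn A B` is `A ⊃ B`; `union A B` is `A ⊕ B`;
`mu .data D` is `μα.D` and `mu .type A` is `μX.A`. -/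
inductive PreTy where
  | bvar (k : VSort) (i : ℕ)
  | fvar (V : TVar)
  | const (c : ℕ)
  | app (D A : PreTy)
  | fn (A B : PreTy)
  | union (A B : PreTy)
  | mu (k : VSort) (A : PreTy)

namespace PreTy

/-- Free (named) type variables. -/
def fv : PreTy → Finset TVar
  | bvar _ _ => ∅
  | fvar V => {V}
  | const _ => ∅
  | app A B => fv A ∪ fv B
  | fn A B => fv A ∪ fv B
  | union A B => fv A ∪ fv B
  | mu _ A => fv A

/-- Replace the bound variable of sort `k` with index `n` by the (locally closed) type `u`. -/
def instAt (k : VSort) (u : PreTy) : ℕ → PreTy → PreTy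
  | n, bvar k' i => if k' = k ∧ i = n then u else bvar k' i
  | _, fvar V => fvar V
  | _, const c => const c
  | n, app A B => app (instAt k u n A) (instAt k u n B)
  | n, fn A B => fn (instAt k u n A) (instAt k u n B)
  | n, union A B => union (instAt k u n A) (instAt k u n B)
  | n, mu k' A => mu k' (instAt k u (if k' = k then n + 1 else n) A)

/-- `inst k B u` is `B{u/V}`, where `B` is the body of the binder `μV` and `V` has sort `k`. -/
def inst (k : VSort) (B u : PreTy) : PreTy := instAt k u 0 B

/-- Open the body of a binder with the named variable `V` (the binder has the sort of `V`). -/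
def openVar (A : PreTy) (V : TVar) : PreTy := inst V.sort A (fvar V)

/-- The two-sorted grammar:
`D ::= α | c | D @ A | D ⊕ D | μα.D` (sort `data`), and
`A ::= X | D | A ⊃ A | A ⊕ A | μX.A` (sort `type`), where the body of `μX` is not itself a
datatype (a recursive type with datatype body is written with a datatype variable). -/
def HasSort : VSort → PreTy → Prop
  | .data, bvar k _ => k = .data
  | .data, fvar V => V.sort = .data
  | .data, const _ => True
  | .data, app D A => HasSort .data D ∧ HasSort .type A
  | .data, fn _ _ => False
  | .data, union A B => HasSort .data A ∧ HasSort .data B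
  | .data, mu .data D => HasSort .data D
  | .data, mu .type _ => False
  | .type, bvar _ _ => True
  | .type, fvar _ => True
  | .type, const _ => True
  | .type, app D A => HasSort .data D ∧ HasSort .type A
  | .type, fn A B => HasSort .type A ∧ HasSort .type B
  | .type, union A B => HasSort .type A ∧ HasSort .type B
  | .type, mu .data D => HasSort .data D
  | .type, mu .type A => HasSort .type A ∧ ¬ HasSort .data A

/-- The expression is a datatype. -/
abbrev IsDatatype (A : PreTy) : Prop := HasSort .data A

/-- All bound-variable indices of sort `k` are `< b k` relative to the surrounding binders. -/
def ClosedAt : (VSort → ℕ) → PreTy → Prop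
  | b, bvar k i => i < b k
  | _, fvar _ => True
  | _, const _ => True
  | b, app A B => ClosedAt b A ∧ ClosedAt b B
  | b, fn A B => ClosedAt b A ∧ ClosedAt b B
  | b, union A B => ClosedAt b A ∧ ClosedAt b B
  | b, mu k A => ClosedAt (Function.update b k (b k + 1)) A

/-- The bound variable of sort `k` with index `n` occurs only under `⊃` or `@`, if at all. -/
def Guarded (k : VSort) : ℕ → PreTy → Prop
  | n, bvar k' i => ¬ (k' = k ∧ i = n)
  | _, fvar _ => True
  | _, const _ => True
  | _, app _ _ => True
  | _, fn _ _ => True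
  | n, union A B => Guarded k n A ∧ Guarded k n B
  | n, mu k' A => Guarded k (if k' = k then n + 1 else n) A

/-- Every recursive subexpression `μV.A` is contractive. -/
def Contractive : PreTy → Prop
  | bvar _ _ => True
  | fvar _ => True
  | const _ => True
  | app A B => Contractive A ∧ Contractive B
  | fn A B => Contractive A ∧ Contractive B
  | union A B => Contractive A ∧ Contractive B
  | mu k A => Guarded k 0 A ∧ Contractive A

/-- `A` is a contractive `μ`-type (possibly with free, named variables). -/
structure WF (A : PreTy) : Prop where
  closed : ClosedAt (fun _ => 0) A
  sorted : HasSort .type A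
  contractive : Contractive A

/-- The root symbol of `A` is `⊕`. -/
def IsUnion : PreTy → Prop
  | union _ _ => True
  | _ => False

/-- The union `A₀ ⊕ A₁ ⊕ … ⊕ Aₙ` of a nonempty family, associated to the left. -/
def bigUnion : {n : ℕ} → (Fin (n + 1) → PreTy) → PreTy
  | 0, A => A 0
  | _ + 1, A => union (bigUnion fun i => A i.castSucc) (A (Fin.last _))

end PreTy

open PreTy in
/-- Type equivalence `A ≃ B` on contractive `μ`-types. -/
inductive EqMu : PreTy → PreTy → Prop
  | refl {A} : WF A → EqMu A A
  | trans {A B C} : EqMu A B → EqMu B C → EqMu A C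
  | symm {A B} : EqMu A B → EqMu B A
  | comp {D D' A A'} : IsDatatype D → IsDatatype D' →
      EqMu D D' → EqMu A A' → EqMu (app D A) (app D' A')
  | func {A A' B B'} : EqMu A A' → EqMu B B' → EqMu (fn A B) (fn A' B')
  | unionIdem {A} : WF A → EqMu (union A A) A
  | unionComm {A B} : WF A → WF B → EqMu (union A B) (union B A)
  | unionAssoc {A B C} : WF A → WF B → WF C →
      EqMu (union A (union B C)) (union (union A B) C)
  | union {A A' B B'} : EqMu A A' → EqMu B B' → EqMu (union A B) (union A' B')
  | recur {A B} (V : TVar) : V ∉ A.fv → V ∉ B.fv →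
      WF (mu V.sort A) → WF (mu V.sort B) →
      EqMu (A.openVar V) (B.openVar V) → EqMu (mu V.sort A) (mu V.sort B)
  | fold {k A} : WF (mu k A) → EqMu (mu k A) (inst k A (mu k A))
  | contr {k A B} : WF (mu k B) → (k = .data → IsDatatype A) →
      EqMu A (inst k B A) → EqMu A (mu k B)

open PreTy in
/-- Subtyping `Σ ⊢ A ⪯ B` on contractive `μ`-types, where the context `S` (standing for `Σ`)
lists assumptions `V ⪯ W` between type variables of any sort.
In `recur`, `V` and `W` are names for the two bound variables, chosen fresh for the context. -/
inductive SubMu : List (TVar × TVar) → PreTy → PreTy → Prop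
  | refl {S A} : WF A → SubMu S A A
  | hyp {S V W} : (V, W) ∈ S → SubMu S (fvar V) (fvar W)
  | eq {S A B} : EqMu A B → SubMu S A B
  | trans {S A B C} : SubMu S A B → SubMu S B C → SubMu S A C
  | comp {S D D' A A'} : IsDatatype D → IsDatatype D' →
      SubMu S D D' → SubMu S A A' → SubMu S (app D A) (app D' A')
  | func {S A A' B B'} : SubMu S A A' → SubMu S B B' → SubMu S (fn A' B) (fn A B')
  | unionL {S A B C} : SubMu S A C → SubMu S B C → SubMu S (union A B) C
  | unionR1 {S A B C} : WF C → SubMu S A B → SubMu S A (union B C)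
  | unionR2 {S A B C} : WF B → SubMu S A C → SubMu S A (union B C)
  | recur {S A B} (V W : TVar) : V ∉ A.fv → W ∉ B.fv →
      W ∉ (A.openVar V).fv → V ∉ (B.openVar W).fv →
      (∀ p ∈ S, p.1 ≠ V ∧ p.1 ≠ W ∧ p.2 ≠ V ∧ p.2 ≠ W) →
      WF (mu V.sort A) → WF (mu W.sort B) →
      SubMu ((V, W) :: S) (A.openVar V) (B.openVar W) →
      SubMu S (mu V.sort A) (mu W.sort B)

/-- Contractive `μ`-types. -/
def MuType : Type := {A : PreTy // A.WF}

/-! ### Patterns and terms -/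

/-- Patterns: matchables, constants and compounds. -/
inductive PrePattern where
  | matchable (x : ℕ)
  | const (c : ℕ)
  | app (p q : PrePattern)

/-- The two directions in a binary node; positions are lists of directions. -/
inductive Dir where
  | fst
  | snd

namespace PrePattern

/-- Free matchables. -/
def fm : PrePattern → Finset ℕ
  | matchable x => {x}
  | const _ => ∅
  | app p q => fm p ∪ fm q

/-- No matchable occurs twice. -/
def Linear : PrePattern → Prop
  | matchable _ => True
  | const _ => True
  | app p q => Linear p ∧ Linear q ∧ Disjoint p.fm q.fm

/-- Apply a substitution of patterns for matchables (the identity outside its domain). -/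
def subst (σ : ℕ → PrePattern) : PrePattern → PrePattern
  | matchable x => σ x
  | const c => const c
  | app p q => app (subst σ p) (subst σ q)

/-- `p` subsumes `q`. -/
def Subsumes (p q : PrePattern) : Prop := ∃ σ, p.subst σ = q

/-- The subpattern at a position, if the position exists. -/
def at? : PrePattern → List Dir → Option PrePattern
  | p, [] => some p
  | app p _, .fst :: π => at? p π
  | app _ q, .snd :: π => at? q π
  | matchable _, _ :: _ => none
  | const _, _ :: _ => none

/-- The set of positions of a pattern. -/
def pos (p : PrePattern) : Set (List Dir) := {π | (p.at? π).isSome}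

end PrePattern

/-- Maximal positions in a set of positions. -/
def maxPos (P : Set (List Dir)) : Set (List Dir) :=
  {π | π ∈ P ∧ ¬ ∃ π', π' ≠ [] ∧ π ++ π' ∈ P}

/-- Mismatching positions between two patterns. -/
def mismatchPos (p q : PrePattern) : Set (List Dir) :=
  {π | π ∈ maxPos (p.pos ∩ q.pos) ∧
    ∀ p' q', p.at? π = some p' → q.at? π = some q' → ¬ p'.Subsumes q'}

/-- Linear patterns. -/
def Pattern : Type := {p : PrePattern // p.Linear}

/-- Typing contexts: partial functions from term variables to contractive `μ`-types. -/
def Ctx : Type := ℕ → Option MuType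

/-- The context `Γ, θ`: the assignments of `θ` are added to `Γ` (and shadow it). -/
def Ctx.extend (Γ θ : Ctx) : Ctx := fun x => (θ x).or (Γ x)

/-- Terms. `abs n p θ s` is the abstraction with the `n + 1 ≥ 1` branches `pᵢ ↦ sᵢ`,
the `i`-th one annotated with the context `θᵢ`; the matchables of `pᵢ` bind in `sᵢ`. -/
inductive Term where
  | var (x : ℕ)
  | const (c : ℕ)
  | app (r u : Term)
  | abs (n : ℕ) (p : Fin (n + 1) → Pattern) (θ : Fin (n + 1) → Ctx) (s : Fin (n + 1) → Term)

/-! ### Compatibility -/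

/-- Symbols that a type may admit at a position. -/
inductive TSym where
  | var (V : TVar)
  | const (c : ℕ)
  | fn
  | app

/-- `Admits A π a`: the type `A` admits the symbol `a` at position `π`. -/
inductive Admits : PreTy → List Dir → TSym → Prop
  | var (V) : Admits (.fvar V) [] (.var V)
  | const (c) : Admits (.const c) [] (.const c)
  | appRoot (A B) : Admits (.app A B) [] .app
  | fnRoot (A B) : Admits (.fn A B) [] .fn
  | appFst {A B π a} : Admits A π a → Admits (.app A B) (.fst :: π) a
  | appSnd {A B π a} : Admits B π a → Admits (.app A B) (.snd :: π) a
  | fnFst {A B π a} : Admits A π a → Admits (.fn A B) (.fst :: π) a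
  | fnSnd {A B π a} : Admits B π a → Admits (.fn A B) (.snd :: π) a
  | unionL {A B π a} : Admits A π a → Admits (.union A B) π a
  | unionR {A B π a} : Admits B π a → Admits (.union A B) π a
  | mu {k A π a} : Admits (PreTy.inst k A (.mu k A)) π a → Admits (.mu k A) π a

/-- The set of symbols that `A` admits at `π`. -/
def symbolsAt (A : PreTy) (π : List Dir) : Set TSym := {a | Admits A π a}

/-- The compatibility predicate for `p : A` and `q : B`. -/
def PComp (p : PrePattern) (A : PreTy) (q : PrePattern) (B : PreTy) : Prop :=
  ∀ π ∈ mismatchPos p q, (symbolsAt A π ∩ symbolsAt B π).Nonempty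

/-- `p : A` is compatible with `q : B`. -/
def Compatible (p : PrePattern) (A : PreTy) (q : PrePattern) (B : PreTy) : Prop :=
  PComp p A q B → SubMu [] B A

/-- Compatibility of a list of typed patterns. -/
def CompatibleList {n : ℕ} (p : Fin n → PrePattern) (A : Fin n → PreTy) : Prop :=
  ∀ i j, i < j → Compatible (p i) (A i) (p j) (A j)

/-! ### Typing -/

/-- Typing of patterns. -/
inductive PatHasType (θ : Ctx) : PrePattern → PreTy → Prop
  | matchable {x} {A : MuType} : θ x = some A → PatHasType θ (.matchable x) A.1
  | const (c) : PatHasType θ (.const c) (.const c)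
  | comp {p q D A} : D.IsDatatype → PatHasType θ p D → PatHasType θ q A →
      PatHasType θ (.app p q) (.app D A)

/-- The domain of `θ` is the set of free matchables of `p`. -/
def DomEq (θ : Ctx) (p : PrePattern) : Prop := ∀ x, (θ x).isSome ↔ x ∈ p.fm

/-- The original typing judgment `Γ ⊢ s : A`, with subsumption. -/
inductive HasType : Ctx → Term → PreTy → Prop
  | var {Γ : Ctx} {x} {A : MuType} : Γ x = some A → HasType Γ (.var x) A.1
  | const {Γ} (c) : HasType Γ (.const c) (.const c)
  | comp {Γ r u D A} : D.IsDatatype → HasType Γ r D → HasType Γ u A →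
      HasType Γ (.app r u) (.app D A)
  | abs {Γ : Ctx} {n : ℕ} {p : Fin (n + 1) → Pattern} {θ : Fin (n + 1) → Ctx}
      {s : Fin (n + 1) → Term} {A : Fin (n + 1) → PreTy} {B : PreTy} :
      CompatibleList (fun i => (p i).1) A →
      (∀ i, PatHasType (θ i) (p i).1 (A i)) →
      (∀ i, DomEq (θ i) (p i).1) →
      (∀ i, HasType (Γ.extend (θ i)) (s i) B) →
      HasType Γ (.abs n p θ s) (.fn (PreTy.bigUnion A) B)
  | app {Γ r u} {n : ℕ} {A : Fin (n + 1) → PreTy} {B : PreTy} (k : Fin (n + 1)) :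
      HasType Γ r (.fn (PreTy.bigUnion A) B) → HasType Γ u (A k) →
      HasType Γ (.app r u) B
  | subs {Γ s A A'} : HasType Γ s A → SubMu [] A A' → HasType Γ s A'

/-- The syntax-directed typing judgment, without subsumption. -/
inductive SDHasType : Ctx → Term → PreTy → Prop
  | var {Γ : Ctx} {x} {A : MuType} : Γ x = some A → SDHasType Γ (.var x) A.1
  | const {Γ} (c) : SDHasType Γ (.const c) (.const c)
  | comp {Γ r u D A} : D.IsDatatype → SDHasType Γ r D → SDHasType Γ u A →
      SDHasType Γ (.app r u) (.app D A)
  | abs {Γ : Ctx} {n : ℕ} {p : Fin (n + 1) → Pattern} {θ : Fin (n + 1) → Ctx}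
      {s : Fin (n + 1) → Term} {A B : Fin (n + 1) → PreTy} :
      CompatibleList (fun i => (p i).1) A →
      (∀ i, PatHasType (θ i) (p i).1 (A i)) →
      (∀ i, DomEq (θ i) (p i).1) →
      (∀ i, SDHasType (Γ.extend (θ i)) (s i) (B i)) →
      SDHasType Γ (.abs n p θ s) (.fn (PreTy.bigUnion A) (PreTy.bigUnion B))
  | app {Γ r u A C} {n : ℕ} {A' B' : Fin (n + 1) → PreTy} :
      SDHasType Γ r A →
      EqMu A (PreTy.bigUnion fun i => .fn (A' i) (B' i)) →
      (∀ i, ¬ (A' i).IsUnion) →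
      SDHasType Γ u C →
      (∀ i, SubMu [] C (A' i)) →
      SDHasType Γ (.app r u) (PreTy.bigUnion B')

end CAP

namespace CAP

/-! ### Substitution of types for named variables -/

/-! Soundness of the syntax-directed system is an induction using only derivable subtypings. For
completeness the hard case is application. The induction hypothesis gives the operator a type `R`
below some `P ⊃ Q`, and the algorithmic rule needs `R` to be equivalent to a union of arrows `Aᵢ ⊃
Bᵢ` with `P ⪯ Aᵢ` and `Bᵢ ⪯ Q`. So subtyping has to be inverted although transitivity is a rule.

The inversion works with the components of a type: what is left after unfolding every `μ` and
splitting every `⊕` at the root. Contractiveness makes this process terminate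
(`WF.unfold_induction`), so a type is equivalent to a finite union of its components
(`EqMu.exists_bigUnion_comp`). If `A ⪯ B`, every component of `A` is matched by a component of `B`
with the same root. For arrows the match also records that domains and codomains are in the
subtyping relation itself; nothing is asked of the arguments of `@`, where only the root matters.
Since arrow arguments are related by the full relation, matching composes under transitivity and can
be proved by rule induction: `EqMu.compSim` for equivalence, `SubMu.compSim` for subtyping.

The recursive rules rest on contractiveness: the components of `B{u/V}` are the components of the
opened body with `u` substituted inside them, so `u` itself never surfaces as a component.

Two side conditions remain. Compounds need that subtypes of datatypes are datatypes
(`SubMu.isDatatype`), again read off the components. The requirement that no `Aᵢ` be a union is met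
by placing a vacuous `μ` in front of it (`EqMu.exists_not_isUnion`). -/

theorem TVar.exists_fresh (k : VSort) (S : Finset TVar) : ∃ V : TVar, V.sort = k ∧ V ∉ S := by
  obtain ⟨i, hi⟩ := Infinite.exists_notMem_finset (S.image TVar.idx)
  exact ⟨⟨k, i⟩, rfl, fun h => hi (Finset.mem_image.2 ⟨_, h, rfl⟩)⟩

namespace PreTy

/-- Simultaneous substitution for the free variables. -/
def subst (σ : TVar → PreTy) : PreTy → PreTy
  | bvar k i => bvar k i
  | fvar V => σ V
  | const c => const c
  | app A B => app (subst σ A) (subst σ B)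
  | fn A B => fn (subst σ A) (subst σ B)
  | union A B => union (subst σ A) (subst σ B)
  | mu k A => mu k (subst σ A)

/-- The substitution is by locally closed types. -/
def ClosedSubst (σ : TVar → PreTy) : Prop := ∀ X, ClosedAt (fun _ => 0) (σ X)

/-- The substitution is by well-formed types that are datatypes exactly at datatype variables. -/
def SortedSubst (σ : TVar → PreTy) : Prop :=
  ∀ X, WF (σ X) ∧ (X.sort = .data ↔ IsDatatype (σ X))

theorem SortedSubst.closed {σ : TVar → PreTy} (h : SortedSubst σ) : ClosedSubst σ :=
  fun X => (h X).1.closed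

theorem subst_fvar (A : PreTy) : subst fvar A = A := by
  induction A <;> simp_all [subst]

theorem subst_congr {σ τ : TVar → PreTy} {A : PreTy} (h : ∀ X ∈ A.fv, σ X = τ X) :
    subst σ A = subst τ A := by
  induction A <;> simp_all [subst, fv]

theorem ClosedAt.mono {A : PreTy} : ∀ {b b' : VSort → ℕ}, ClosedAt b A → (∀ k, b k ≤ b' k) →
    ClosedAt b' A := by
  induction A with
  | bvar k i => exact fun h h' => lt_of_lt_of_le h (h' k)
  | fvar V => exact fun _ _ => trivial
  | const c => exact fun _ _ => trivial
  | app A B ihA ihB => exact fun h h' => ⟨ihA h.1 h', ihB h.2 h'⟩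
  | fn A B ihA ihB => exact fun h h' => ⟨ihA h.1 h', ihB h.2 h'⟩
  | union A B ihA ihB => exact fun h h' => ⟨ihA h.1 h', ihB h.2 h'⟩
  | mu k A ih =>
    intro b b' h h'
    refine ih h fun j => ?_
    by_cases hj : j = k
    · subst hj; simpa using h' j
    · simpa [Function.update_of_ne hj] using h' j

theorem ClosedAt.of_zero {A : PreTy} (h : ClosedAt (fun _ => 0) A) (b : VSort → ℕ) :
    ClosedAt b A := h.mono fun _ => Nat.zero_le _

theorem instAt_of_closedAt {k : VSort} {u A : PreTy} : ∀ {b : VSort → ℕ} {n : ℕ},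
    ClosedAt b A → b k ≤ n → instAt k u n A = A := by
  induction A with
  | bvar k' i =>
    intro b n h hn
    simp only [ClosedAt] at h
    rw [instAt, if_neg]
    rintro ⟨rfl, rfl⟩
    omega
  | fvar V => exact fun _ _ => rfl
  | const c => exact fun _ _ => rfl
  | app A B ihA ihB => intro b n h hn; rw [instAt, ihA h.1 hn, ihB h.2 hn]
  | fn A B ihA ihB => intro b n h hn; rw [instAt, ihA h.1 hn, ihB h.2 hn]
  | union A B ihA ihB => intro b n h hn; rw [instAt, ihA h.1 hn, ihB h.2 hn]
  | mu k' A ih =>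
    intro b n h hn
    rw [instAt, ih h]
    by_cases hk : k' = k
    · subst hk; simpa using hn
    · simpa [hk, Function.update_of_ne (Ne.symm hk)] using hn

theorem inst_of_closed {k : VSort} {u A : PreTy} (h : ClosedAt (fun _ => 0) A) :
    inst k A u = A := instAt_of_closedAt h le_rfl

theorem subst_instAt {σ : TVar → PreTy} (hσ : ClosedSubst σ) (k : VSort) (u A : PreTy) :
    ∀ n, subst σ (instAt k u n A) = instAt k (subst σ u) n (subst σ A) := by
  induction A with
  | bvar k' i => intro n; simp only [instAt, subst]; split_ifs <;> rfl
  | fvar V => intro n; exact (instAt_of_closedAt (hσ V) (Nat.zero_le _)).symm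
  | const c => exact fun _ => rfl
  | app A B ihA ihB => intro n; simp [instAt, subst, ihA, ihB]
  | fn A B ihA ihB => intro n; simp [instAt, subst, ihA, ihB]
  | union A B ihA ihB => intro n; simp [instAt, subst, ihA, ihB]
  | mu k' A ih => intro n; simp [instAt, subst, ih]

theorem subst_inst {σ : TVar → PreTy} (hσ : ClosedSubst σ) (k : VSort) (u A : PreTy) :
    subst σ (inst k A u) = inst k (subst σ A) (subst σ u) := subst_instAt hσ k u A 0

theorem subst_openVar {σ : TVar → PreTy} (hσ : ClosedSubst σ) (A : PreTy) (V : TVar) :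
    subst σ (A.openVar V) = inst V.sort (subst σ A) (σ V) := subst_inst hσ _ _ _

theorem ClosedAt.instAt {k : VSort} {u A : PreTy} (hu : ClosedAt (fun _ => 0) u) :
    ∀ {n : ℕ} {b b' : VSort → ℕ}, ClosedAt b' A → b k = n → b' k = n + 1 →
      (∀ j, j ≠ k → b' j = b j) → ClosedAt b (instAt k u n A) := by
  induction A with
  | bvar k' i =>
    intro n b b' h h1 h2 h3
    simp only [ClosedAt] at h
    simp only [PreTy.instAt]
    split_ifs with hc
    · exact hu.of_zero b
    · simp only [ClosedAt]
      by_cases hk : k' = k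
      · subst hk; simp at hc; omega
      · rw [← h3 k' hk]; exact h
  | fvar V => intros; trivial
  | const c => intros; trivial
  | app A B ihA ihB => exact fun h h1 h2 h3 => ⟨ihA h.1 h1 h2 h3, ihB h.2 h1 h2 h3⟩
  | fn A B ihA ihB => exact fun h h1 h2 h3 => ⟨ihA h.1 h1 h2 h3, ihB h.2 h1 h2 h3⟩
  | union A B ihA ihB => exact fun h h1 h2 h3 => ⟨ihA h.1 h1 h2 h3, ihB h.2 h1 h2 h3⟩
  | mu k' A ih =>
    intro n b b' h h1 h2 h3
    simp only [PreTy.instAt, ClosedAt] at h ⊢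
    by_cases hk : k' = k
    · subst hk
      rw [if_pos rfl]
      refine ih h (by simp [h1]) (by simp [h2]) fun j hj => ?_
      simp [Function.update_of_ne hj, h3 j hj]
    · rw [if_neg hk]
      refine ih h (by simp [Function.update_of_ne (Ne.symm hk), h1])
        (by simp [Function.update_of_ne (Ne.symm hk), h2]) fun j hj => ?_
      by_cases hj' : j = k'
      · subst hj'; simp [h3 j hj]
      · simp [Function.update_of_ne hj', h3 j hj]

theorem ClosedAt.inst {k : VSort} {u A : PreTy} (hu : ClosedAt (fun _ => 0) u)
    (hA : ClosedAt (fun _ => 0) (mu k A)) : ClosedAt (fun _ => 0) (inst k A u) :=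
  ClosedAt.instAt hu hA rfl (by simp) fun j hj => by simp [Function.update_of_ne hj]

theorem ClosedAt.subst {σ : TVar → PreTy} (hσ : ClosedSubst σ) {A : PreTy} :
    ∀ {b : VSort → ℕ}, ClosedAt b A → ClosedAt b (subst σ A) := by
  induction A with
  | bvar k i => exact fun h => h
  | fvar V => exact fun _ => (hσ V).of_zero _
  | const c => exact fun h => h
  | app A B ihA ihB => exact fun h => ⟨ihA h.1, ihB h.2⟩
  | fn A B ihA ihB => exact fun h => ⟨ihA h.1, ihB h.2⟩
  | union A B ihA ihB => exact fun h => ⟨ihA h.1, ihB h.2⟩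
  | mu k A ih => exact fun h => ih h

/-! ### Sorts -/

/-- The symbols at the root of an expression, up to `⊕` and `μ`, are those of datatypes. -/
def SpineData : PreTy → Prop
  | bvar k _ => k = .data
  | fvar V => V.sort = .data
  | const _ => True
  | app _ _ => True
  | fn _ _ => False
  | union A B => SpineData A ∧ SpineData B
  | mu _ A => SpineData A

theorem HasSort.to_type {A : PreTy} (h : HasSort .data A) : HasSort .type A := by
  induction A with
  | mu k A ih => cases k <;> simp_all [HasSort]
  | _ => simp_all [HasSort]

/-- For a well-sorted type only the spine decides whether it is a datatype: the sort condition on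
`@` is the same in both sorts, and a binder `μX` has by the grammar a body that is not a datatype.
-/
theorem HasSort.data_iff {A : PreTy} (h : HasSort .type A) : HasSort .data A ↔ SpineData A := by
  induction A with
  | mu k A ih =>
    cases k with
    | data =>
      simp only [HasSort, SpineData] at h ⊢
      exact ih h.to_type
    | type =>
      simp only [HasSort, SpineData, false_iff] at h ⊢
      exact fun h' => h.2 ((ih h.1).2 h')
  | _ => simp_all [HasSort, SpineData]

/-- An equivalence is needed, not just preservation: the body of `μX` must not be a datatype, so
substitution must not create datatypes either. This is why `SortedSubst` is stated with an iff. -/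
theorem SpineData.subst_iff {σ : TVar → PreTy} (hσ : SortedSubst σ) (A : PreTy) :
    SpineData (A.subst σ) ↔ SpineData A := by
  induction A with
  | fvar V => exact (HasSort.data_iff (hσ V).1.sorted).symm.trans (hσ V).2.symm
  | _ => simp_all [subst, SpineData]

theorem SpineData.instAt_iff {k : VSort} {u : PreTy} (hu : k = .data ↔ SpineData u) (A : PreTy) :
    ∀ n, SpineData (instAt k u n A) ↔ SpineData A := by
  induction A with
  | bvar k' i =>
    intro n
    simp only [instAt]
    split_ifs with h
    · rw [← hu, ← h.1]; rfl
    · rfl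
  | _ => intro n; simp_all [instAt, SpineData]

theorem HasSort.subst {σ : TVar → PreTy} (hσ : SortedSubst σ) {A : PreTy} :
    ∀ {k}, HasSort k A → HasSort k (A.subst σ) := by
  induction A with
  | fvar V =>
    intro k h
    cases k with
    | data => exact (hσ V).2.1 h
    | type => exact (hσ V).1.sorted
  | mu k' A ih =>
    intro k h
    cases k <;> cases k' <;> simp only [HasSort, PreTy.subst] at h ⊢
    · exact ih h
    · exact ih h
    -- The negative condition on the body of `μX` is pulled back along the spine.
    · refine ⟨ih h.1, fun h' => h.2 ?_⟩
      rw [h.1.data_iff, ← SpineData.subst_iff hσ]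
      exact (data_iff h'.to_type).1 h'
  | bvar k' i => exact fun h => h
  | const c => exact fun h => h
  | app A B ihA ihB => intro k h; cases k <;> exact ⟨ihA h.1, ihB h.2⟩
  | fn A B ihA ihB =>
    intro k h
    cases k with
    | data => exact h
    | type => exact ⟨ihA h.1, ihB h.2⟩
  | union A B ihA ihB => intro k h; cases k <;> exact ⟨ihA h.1, ihB h.2⟩

theorem HasSort.instAt {k' : VSort} {u : PreTy} (hu : HasSort .type u)
    (hu' : k' = .data ↔ HasSort .data u) {A : PreTy} :
    ∀ {k n}, HasSort k A → HasSort k (instAt k' u n A) := by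
  induction A with
  | bvar k'' i =>
    intro k n h
    simp only [PreTy.instAt]
    split_ifs with hc
    · cases k with
      | data => exact hu'.1 (hc.1.symm.trans h)
      | type => exact hu
    · exact h
  | mu k'' A ih =>
    intro k n h
    cases k <;> cases k'' <;> simp only [HasSort, PreTy.instAt] at h ⊢
    · exact ih h
    · exact ih h
    · refine ⟨ih h.1, fun h' => h.2 ?_⟩
      rw [h.1.data_iff, ← SpineData.instAt_iff (hu'.trans hu.data_iff)]
      exact (data_iff h'.to_type).1 h'
  | fvar V => exact fun h => h
  | const c => exact fun h => h
  | app A B ihA ihB => intro k n h; cases k <;> exact ⟨ihA h.1, ihB h.2⟩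
  | fn A B ihA ihB =>
    intro k n h
    cases k with
    | data => exact h
    | type => exact ⟨ihA h.1, ihB h.2⟩
  | union A B ihA ihB => intro k n h; cases k <;> exact ⟨ihA h.1, ihB h.2⟩

theorem HasSort.mu_data_iff {k : VSort} {A : PreTy} (h : HasSort .type (mu k A)) :
    k = .data ↔ HasSort .data (mu k A) := by
  cases k with
  | data => exact ⟨fun _ => h, fun _ => rfl⟩
  | type => simp [HasSort]

theorem HasSort.mu_body {k : VSort} {A : PreTy} (h : HasSort .type (mu k A)) :
    HasSort .type A := by
  cases k with
  | data => exact HasSort.to_type h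
  | type => exact h.1

/-! ### Contractiveness -/

theorem Guarded.of_closedAt {k : VSort} {A : PreTy} : ∀ {b : VSort → ℕ} {n : ℕ},
    ClosedAt b A → b k ≤ n → Guarded k n A := by
  induction A with
  | bvar k' i =>
    rintro b n h hn ⟨rfl, rfl⟩
    simp only [ClosedAt] at h
    omega
  | fvar V => intros; trivial
  | const c => intros; trivial
  | app A B ihA ihB => intros; trivial
  | fn A B ihA ihB => intros; trivial
  | union A B ihA ihB => exact fun h hn => ⟨ihA h.1 hn, ihB h.2 hn⟩
  | mu k' A ih =>
    intro b n h hn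
    refine ih h ?_
    by_cases hk : k' = k
    · subst hk; simpa using hn
    · simpa [hk, Function.update_of_ne (Ne.symm hk)] using hn

theorem Guarded.subst {σ : TVar → PreTy} (hσ : ClosedSubst σ) {k : VSort} {A : PreTy} :
    ∀ {n}, Guarded k n A → Guarded k n (A.subst σ) := by
  induction A with
  | fvar V => exact fun _ => Guarded.of_closedAt (hσ V) (Nat.zero_le _)
  | union A B ihA ihB => exact fun h => ⟨ihA h.1, ihB h.2⟩
  | mu k' A ih => exact fun h => ih h
  | _ => exact fun h => h

theorem Contractive.subst {σ : TVar → PreTy} (hσ : ClosedSubst σ)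
    (hσ' : ∀ X, Contractive (σ X)) {A : PreTy} (h : Contractive A) :
    Contractive (A.subst σ) := by
  induction A with
  | fvar V => exact hσ' V
  | app A B ihA ihB => exact ⟨ihA h.1, ihB h.2⟩
  | fn A B ihA ihB => exact ⟨ihA h.1, ihB h.2⟩
  | union A B ihA ihB => exact ⟨ihA h.1, ihB h.2⟩
  | mu k' A ih => exact ⟨h.1.subst hσ, ih h.2⟩
  | _ => exact h

theorem Guarded.instAt {k k' : VSort} {u : PreTy} (hu : ClosedAt (fun _ => 0) u) {A : PreTy} :
    ∀ {m n}, Guarded k m A → Guarded k m (instAt k' u n A) := by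
  induction A with
  | bvar k'' i =>
    intro m n h
    simp only [PreTy.instAt]
    split_ifs
    · exact Guarded.of_closedAt hu (Nat.zero_le _)
    · exact h
  | union A B ihA ihB => exact fun h => ⟨ihA h.1, ihB h.2⟩
  | mu k' A ih => exact fun h => ih h
  | fvar V => exact fun h => h
  | const c => exact fun h => h
  | _ => exact fun _ => trivial

theorem Contractive.instAt {k : VSort} {u : PreTy} (hu : ClosedAt (fun _ => 0) u)
    (hu' : Contractive u) {A : PreTy} : ∀ {n}, Contractive A → Contractive (instAt k u n A) := by
  induction A with
  | bvar k' i =>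
    intro n h
    simp only [PreTy.instAt]
    split_ifs
    · exact hu'
    · exact h
  | app A B ihA ihB => exact fun h => ⟨ihA h.1, ihB h.2⟩
  | fn A B ihA ihB => exact fun h => ⟨ihA h.1, ihB h.2⟩
  | union A B ihA ihB => exact fun h => ⟨ihA h.1, ihB h.2⟩
  | mu k' A ih => exact fun h => ⟨h.1.instAt hu, ih h.2⟩
  | fvar V => exact fun h => h
  | const c => exact fun h => h

/-! ### Well-formedness -/

theorem WF.fvar (V : TVar) : WF (fvar V) := ⟨trivial, trivial, trivial⟩

theorem WF.const (c : ℕ) : WF (const c) := ⟨trivial, trivial, trivial⟩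

theorem WF.app {A B : PreTy} (hA : WF A) (hA' : IsDatatype A) (hB : WF B) : WF (app A B) :=
  ⟨⟨hA.1, hB.1⟩, ⟨hA', hB.2⟩, ⟨hA.3, hB.3⟩⟩

theorem WF.fn {A B : PreTy} (hA : WF A) (hB : WF B) : WF (fn A B) :=
  ⟨⟨hA.1, hB.1⟩, ⟨hA.2, hB.2⟩, ⟨hA.3, hB.3⟩⟩

theorem WF.union {A B : PreTy} (hA : WF A) (hB : WF B) : WF (union A B) :=
  ⟨⟨hA.1, hB.1⟩, ⟨hA.2, hB.2⟩, ⟨hA.3, hB.3⟩⟩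

theorem WF.app_left {A B : PreTy} (h : WF (.app A B)) : WF A ∧ IsDatatype A :=
  ⟨⟨h.1.1, HasSort.to_type h.2.1, h.3.1⟩, h.2.1⟩

theorem WF.app_right {A B : PreTy} (h : WF (.app A B)) : WF B := ⟨h.1.2, h.2.2, h.3.2⟩

theorem WF.fn_left {A B : PreTy} (h : WF (.fn A B)) : WF A := ⟨h.1.1, h.2.1, h.3.1⟩

theorem WF.fn_right {A B : PreTy} (h : WF (.fn A B)) : WF B := ⟨h.1.2, h.2.2, h.3.2⟩

theorem WF.union_left {A B : PreTy} (h : WF (.union A B)) : WF A := ⟨h.1.1, h.2.1, h.3.1⟩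

theorem WF.union_right {A B : PreTy} (h : WF (.union A B)) : WF B := ⟨h.1.2, h.2.2, h.3.2⟩

theorem WF.subst {σ : TVar → PreTy} (hσ : SortedSubst σ) {A : PreTy} (h : WF A) :
    WF (A.subst σ) :=
  ⟨h.closed.subst hσ.closed, h.sorted.subst hσ,
    h.contractive.subst hσ.closed fun X => (hσ X).1.contractive⟩

theorem WF.inst {k : VSort} {A u : PreTy} (h : WF (mu k A)) (hu : WF u)
    (hu' : k = .data ↔ IsDatatype u) : WF (inst k A u) :=
  ⟨hu.closed.inst h.closed, HasSort.instAt hu.sorted hu' h.sorted.mu_body,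
    Contractive.instAt hu.closed hu.contractive h.contractive.2⟩

theorem WF.unfold {k : VSort} {A : PreTy} (h : WF (mu k A)) : WF (PreTy.inst k A (mu k A)) :=
  h.inst h h.sorted.mu_data_iff

theorem WF.openVar {A : PreTy} {V : TVar} (h : WF (mu V.sort A)) : WF (A.openVar V) :=
  h.inst (WF.fvar V) Iff.rfl

theorem WF.bigUnion : ∀ {n : ℕ} {A : Fin (n + 1) → PreTy}, (∀ i, WF (A i)) → WF (bigUnion A)
  | 0, _, h => h 0
  | _ + 1, _, h => (WF.bigUnion fun i => h i.castSucc).union (h (Fin.last _))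

theorem WF.of_bigUnion : ∀ {n : ℕ} {A : Fin (n + 1) → PreTy}, WF (PreTy.bigUnion A) →
    ∀ i, WF (A i)
  | 0, _, h, i => by rw [Fin.eq_zero i]; exact h
  | _ + 1, _, h, i => by
    refine Fin.lastCases ?_ (fun j => ?_) i
    · exact h.union_right
    · exact WF.of_bigUnion h.union_left j

theorem SortedSubst.fvar : SortedSubst fvar := fun X => ⟨WF.fvar X, Iff.rfl⟩

theorem SortedSubst.update {σ : TVar → PreTy} (hσ : SortedSubst σ) {V : TVar} {u : PreTy}
    (hu : WF u) (hu' : V.sort = .data ↔ IsDatatype u) : SortedSubst (Function.update σ V u) := by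
  intro X
  by_cases h : X = V
  · subst h; simpa using ⟨hu, hu'⟩
  · simpa [Function.update_of_ne h] using hσ X

theorem SortedSubst.update_fvar {σ : TVar → PreTy} (hσ : SortedSubst σ) {V W : TVar}
    (h : W.sort = V.sort) : SortedSubst (Function.update σ V (.fvar W)) :=
  hσ.update (WF.fvar W) (by rw [← h]; rfl)

theorem ClosedSubst.fvar : ClosedSubst fvar := SortedSubst.fvar.closed

theorem ClosedSubst.update {σ : TVar → PreTy} (hσ : ClosedSubst σ) (V : TVar) {u : PreTy}
    (hu : ClosedAt (fun _ => 0) u) : ClosedSubst (Function.update σ V u) := by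
  intro X
  by_cases h : X = V
  · subst h; simpa using hu
  · simpa [Function.update_of_ne h] using hσ X

/-! ### Free variables -/

theorem fv_instAt_subset (k : VSort) (u A : PreTy) : ∀ n, (instAt k u n A).fv ⊆ A.fv ∪ u.fv := by
  induction A with
  | bvar k' i => intro n; simp only [instAt]; split_ifs <;> simp [fv]
  | fvar V => intro n; simp [instAt, fv]
  | const c => intro n; simp [instAt, fv]
  | mu k' A ih => exact fun n => ih _
  | _ A B ihA ihB =>
    intro n
    simp only [instAt, fv]
    have h1 := ihA n
    have h2 := ihB n
    grind

theorem subset_fv_instAt (k : VSort) (u A : PreTy) : ∀ n, A.fv ⊆ (instAt k u n A).fv := by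
  induction A with
  | mu k' A ih => exact fun n => ih _
  | bvar k' i => intro n; simp [fv]
  | fvar V => exact fun _ => subset_rfl
  | const c => exact fun _ => subset_rfl
  | _ A B ihA ihB =>
    intro n
    exact Finset.union_subset_union (ihA n) (ihB n)

theorem mem_fv_openVar {A : PreTy} {V X : TVar} (h : X ∈ (A.openVar V).fv) :
    X ∈ A.fv ∨ X = V := by
  simpa [fv, or_comm] using fv_instAt_subset V.sort (.fvar V) A 0 h

theorem subset_fv_openVar (A : PreTy) (V : TVar) : A.fv ⊆ (A.openVar V).fv :=
  subset_fv_instAt _ _ _ 0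

theorem mem_fv_subst {σ : TVar → PreTy} {A : PreTy} {W : TVar} :
    W ∈ (A.subst σ).fv ↔ ∃ X ∈ A.fv, W ∈ (σ X).fv := by
  induction A <;> simp_all [subst, fv, or_and_right, exists_or]

theorem subst_update_of_notMem {σ : TVar → PreTy} {A : PreTy} {V : TVar} (h : V ∉ A.fv)
    (u : PreTy) : subst (Function.update σ V u) A = subst σ A :=
  subst_congr fun X hX => Function.update_of_ne (by rintro rfl; exact h hX) _ _

/-- Substitution for the variable with which a binder was opened. -/
theorem subst_update_openVar {σ : TVar → PreTy} (hσ : ClosedSubst σ) {A u : PreTy} {V : TVar}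
    (hu : ClosedAt (fun _ => 0) u) (hV : V ∉ A.fv) :
    subst (Function.update σ V u) (A.openVar V) = inst V.sort (subst σ A) u := by
  rw [subst_openVar (hσ.update V hu), subst_update_of_notMem hV, Function.update_self]

theorem subst_update_openVar_fvar {σ : TVar → PreTy} (hσ : ClosedSubst σ) {A : PreTy}
    {V W : TVar} (hV : V ∉ A.fv) (hW : W.sort = V.sort) :
    subst (Function.update σ V (.fvar W)) (A.openVar V) = (subst σ A).openVar W := by
  rw [subst_update_openVar hσ (WF.fvar W).closed hV, PreTy.openVar, hW]

/-! ### Components of a type -/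

/-- `Comp A C`: unfolding recursive types and splitting unions in `A` leads to `C`, which
is neither a recursive type nor a union. -/
inductive Comp : PreTy → PreTy → Prop
  | fvar (V) : Comp (fvar V) (fvar V)
  | const (c) : Comp (const c) (const c)
  | app (A B) : Comp (app A B) (app A B)
  | fn (A B) : Comp (fn A B) (fn A B)
  | unionL {A B C} : Comp A C → Comp (union A B) C
  | unionR {A B C} : Comp B C → Comp (union A B) C
  | mu {k A C} : Comp (inst k A (mu k A)) C → Comp (mu k A) C

theorem Comp.wf {A C : PreTy} (h : Comp A C) : WF A → WF C := by
  induction h with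
  | unionL _ ih => exact fun h => ih h.union_left
  | unionR _ ih => exact fun h => ih h.union_right
  | mu _ ih => exact fun h => ih h.unfold
  | _ => exact fun h => h

theorem Comp.fv_subset {A C : PreTy} (h : Comp A C) : C.fv ⊆ A.fv := by
  induction h with
  | unionL _ ih => exact ih.trans Finset.subset_union_left
  | unionR _ ih => exact ih.trans Finset.subset_union_right
  | mu _ ih => exact ih.trans ((fv_instAt_subset _ _ _ 0).trans (by simp [fv]))
  | _ => exact subset_rfl

theorem Comp.subst {σ : TVar → PreTy} (hσ : ClosedSubst σ) {A C C' : PreTy} (h : Comp A C)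
    (h' : Comp (C.subst σ) C') : Comp (A.subst σ) C' := by
  induction h with
  | unionL _ ih => exact .unionL (ih h')
  | unionR _ ih => exact .unionR (ih h')
  | mu _ ih =>
    refine .mu ?_
    have := ih h'
    rwa [subst_inst hσ] at this
  | _ => exact h'

/-- Each unfolding or splitting step in the substituted type comes from one in `A`, until a variable
of `A` is reached; from there on the steps take place inside its image. -/
theorem Comp.of_subst {σ : TVar → PreTy} (hσ : ClosedSubst σ) {A C' : PreTy}
    (h : Comp (A.subst σ) C') : ∃ C, Comp A C ∧ Comp (C.subst σ) C' := by
  generalize hS : A.subst σ = S at h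
  -- Any root of the substituted type may come from a variable of `A`; that case is settled once
  -- here for all branches.
  have key : ∀ V, A = .fvar V → ∃ C, Comp A C ∧ Comp (C.subst σ) C' := by
    rintro V rfl
    exact ⟨_, .fvar V, by rw [hS]; exact h⟩
  induction h generalizing A with
  | fvar W => (cases A <;> simp [PreTy.subst] at hS); exact key _ rfl
  | const c =>
    cases A <;> simp [PreTy.subst] at hS
    · exact key _ rfl
    · exact ⟨_, .const _, by subst hS; exact .const _⟩
  | app B D =>
    cases A <;> simp [PreTy.subst] at hS
    · exact key _ rfl
    · exact ⟨_, .app _ _, by simp only [PreTy.subst, hS]; exact .app _ _⟩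
  | fn B D =>
    cases A <;> simp [PreTy.subst] at hS
    · exact key _ rfl
    · exact ⟨_, .fn _ _, by simp only [PreTy.subst, hS]; exact .fn _ _⟩
  | @unionL B1 B2 C h ih =>
    cases A <;> simp [PreTy.subst] at hS
    · exact key _ rfl
    · obtain ⟨C0, h1, h2⟩ := ih hS.1 fun V hV => ⟨.fvar V, hV ▸ .fvar V, by
        rw [← hV, hS.1]; exact h⟩
      exact ⟨C0, .unionL h1, h2⟩
  | @unionR B1 B2 C h ih =>
    cases A <;> simp [PreTy.subst] at hS
    · exact key _ rfl
    · obtain ⟨C0, h1, h2⟩ := ih hS.2 fun V hV => ⟨.fvar V, hV ▸ .fvar V, by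
        rw [← hV, hS.2]; exact h⟩
      exact ⟨C0, .unionR h1, h2⟩
  | @mu k B C h ih =>
    cases A <;> simp [PreTy.subst] at hS
    · exact key _ rfl
    · rename_i k' A
      obtain ⟨rfl, rfl⟩ := hS
      have e : (inst k' A (.mu k' A)).subst σ = inst k' (A.subst σ) (.mu k' (A.subst σ)) :=
        subst_inst hσ _ _ _
      obtain ⟨C0, h1, h2⟩ := ih e fun V hV => ⟨.fvar V, hV ▸ .fvar V, by
        rw [← hV, e]; exact h⟩
      exact ⟨C0, .mu h1, h2⟩

/-- The number of `⊕` and `μ` above the components. -/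
def spineSize : PreTy → ℕ
  | union A B => spineSize A + spineSize B + 1
  | mu _ A => spineSize A + 1
  | _ => 0

/-- A guarded variable lies below some `⊃` or `@`, hence outside the part that is counted. -/
theorem spineSize_instAt {k : VSort} {u A : PreTy} : ∀ {n}, Guarded k n A →
    spineSize (instAt k u n A) = spineSize A := by
  induction A with
  | bvar k' i => intro n h; rw [instAt, if_neg h]
  | union A B ihA ihB => intro n h; simp [instAt, spineSize, ihA h.1, ihB h.2]
  | mu k' A ih => intro n h; simp [instAt, spineSize, ih h]
  | _ => exact fun _ => rfl

/-- Induction along the unfolding of recursive types. -/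
theorem WF.unfold_induction {P : ∀ A : PreTy, WF A → Prop}
    (fvar : ∀ V, P (.fvar V) (WF.fvar V)) (const : ∀ c, P (.const c) (WF.const c))
    (app : ∀ A B, ∀ h : WF (.app A B), P (.app A B) h)
    (fn : ∀ A B, ∀ h : WF (.fn A B), P (.fn A B) h)
    (union : ∀ A B, ∀ (hA : WF A) (hB : WF B), P A hA → P B hB → P (.union A B) (hA.union hB))
    (mu : ∀ k A, ∀ h : WF (.mu k A), P (PreTy.inst k A (.mu k A)) h.unfold → P (.mu k A) h)
    (A : PreTy) (h : WF A) : P A h := by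
  suffices ∀ n A, spineSize A = n → ∀ h : WF A, P A h from this _ A rfl h
  intro n
  induction n using Nat.strong_induction_on with
  | _ n ih =>
    intro A hn h
    subst hn
    cases A with
    | bvar k i => exact absurd h.closed (Nat.not_lt_zero _)
    | fvar V => exact fvar V
    | const c => exact const c
    | app A B => exact app A B h
    | fn A B => exact fn A B h
    | union A B =>
      exact union A B h.union_left h.union_right
        (ih _ (by simp only [spineSize]; omega) A rfl h.union_left)
        (ih _ (by simp only [spineSize]; omega) B rfl h.union_right)
    | mu k A =>
      -- Unfolding removes one `μ` from the spine and, by contractiveness, adds nothing to it.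
      refine mu k A h (ih _ ?_ _ rfl h.unfold)
      rw [PreTy.inst, spineSize_instAt h.contractive.1]
      simp [spineSize]

/-- The variable `V` is among the components. -/
def InSpine (V : TVar) : PreTy → Prop
  | fvar W => W = V
  | union A B => InSpine V A ∨ InSpine V B
  | mu _ A => InSpine V A
  | _ => False

theorem InSpine.mem_fv {V : TVar} {A : PreTy} (h : InSpine V A) : V ∈ A.fv := by
  induction A with
  | fvar W => simp_all [InSpine, fv]
  | union A B ihA ihB =>
    exact Finset.mem_union.2 (h.imp ihA ihB)
  | mu k A ih => exact ih h
  | _ => exact h.elim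

theorem inSpine_instAt_iff {V : TVar} {k : VSort} {u A : PreTy} : ∀ {n}, Guarded k n A →
    (InSpine V (instAt k u n A) ↔ InSpine V A) := by
  induction A with
  | bvar k' i => intro n h; rw [instAt, if_neg h]
  | union A B ihA ihB => intro n h; simp [instAt, InSpine, ihA h.1, ihB h.2]
  | mu k' A ih => intro n h; simp [instAt, InSpine, ih h]
  | _ => exact fun _ => Iff.rfl

theorem Comp.inSpine {A C : PreTy} (h : Comp A C) {V : TVar} (hC : C = .fvar V) :
    WF A → InSpine V A := by
  induction h with
  | fvar W => exact fun _ => PreTy.fvar.inj hC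
  | unionL _ ih => exact fun h => .inl (ih hC h.union_left)
  | unionR _ ih => exact fun h => .inr (ih hC h.union_right)
  | mu _ ih => exact fun h => (inSpine_instAt_iff h.contractive.1).1 (ih hC h.unfold)
  | _ => cases hC

/-- Contractiveness keeps the bound variable off the spine, and unfolding cannot bring it there. -/
theorem Comp.not_openVar {A : PreTy} {V : TVar} (hV : V ∉ A.fv) (h : WF (.mu V.sort A)) :
    ¬ Comp (A.openVar V) (.fvar V) := fun hc =>
  hV ((inSpine_instAt_iff h.contractive.1).1 (hc.inSpine rfl h.openVar)).mem_fv

theorem Comp.ne_union {A C : PreTy} (h : Comp A C) (P Q : PreTy) : C ≠ .union P Q := by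
  induction h with
  | unionL _ ih => exact ih
  | unionR _ ih => exact ih
  | mu _ ih => exact ih
  | _ => exact nofun

theorem Comp.ne_mu {A C : PreTy} (h : Comp A C) (k : VSort) (P : PreTy) : C ≠ .mu k P := by
  induction h with
  | unionL _ ih => exact ih
  | unionR _ ih => exact ih
  | mu _ ih => exact ih
  | _ => exact nofun

/-- The components of `C` under a substitution that only matters at other variables. -/
theorem Comp.eq_of_subst {σ : TVar → PreTy} {C C' : PreTy} (h : Comp (C.subst σ) C') {A : PreTy}
    (hC : Comp A C) (hσ : ∀ X, C = .fvar X → σ X = .fvar X) : C' = C.subst σ := by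
  induction hC with
  | fvar V => rw [PreTy.subst, hσ V rfl] at h ⊢; cases h; rfl
  | const c => cases h; rfl
  | app A B => cases h; rfl
  | fn A B => cases h; rfl
  | unionL _ ih => exact ih h hσ
  | unionR _ ih => exact ih h hσ
  | mu _ ih => exact ih h hσ

theorem Comp.subst_self {σ : TVar → PreTy} {A C : PreTy} (hC : Comp A C)
    (hσ : ∀ X, C = .fvar X → σ X = .fvar X) : Comp (C.subst σ) (C.subst σ) := by
  induction hC with
  | fvar V => rw [PreTy.subst, hσ V rfl]; exact .fvar V
  | const c => exact .const c
  | app A B => exact .app _ _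
  | fn A B => exact .fn _ _
  | unionL _ ih => exact ih hσ
  | unionR _ ih => exact ih hσ
  | mu _ ih => exact ih hσ

/-! ### Components of instances of a binder's body -/

theorem inst_eq_subst_openVar {σ : TVar → PreTy} (hσ : ClosedSubst σ) {A : PreTy} {V : TVar}
    (hσA : ∀ X ∈ A.fv, σ X = .fvar X) : inst V.sort A (σ V) = (A.openVar V).subst σ := by
  rw [subst_openVar hσ, subst_congr hσA, subst_fvar]

/-- The components of an instance of the body of a binder, in terms of the opened body. -/
theorem Comp.of_inst {A C : PreTy} {V : TVar} {σ : TVar → PreTy} (hV : V ∉ A.fv)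
    (h : WF (.mu V.sort A)) (hσ : ClosedSubst σ) (hσA : ∀ X ∈ A.fv, σ X = .fvar X)
    (hC : Comp (inst V.sort A (σ V)) C) :
    ∃ C₀, Comp (A.openVar V) C₀ ∧ (∀ X, C₀ = .fvar X → X ∈ A.fv) ∧ C = C₀.subst σ := by
  rw [inst_eq_subst_openVar hσ hσA] at hC
  obtain ⟨C₀, h1, h2⟩ := hC.of_subst hσ
  have hne : ∀ X, C₀ = .fvar X → X ∈ A.fv := by
    rintro X rfl
    refine (mem_fv_openVar (h1.fv_subset (by simp [fv]))).resolve_right ?_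
    rintro rfl
    exact h1.not_openVar hV h
  exact ⟨C₀, h1, hne, h2.eq_of_subst h1 fun X hX => hσA X (hne X hX)⟩

/-- The converse of `Comp.of_inst`: no new unfolding starts after substitution, since the component
is not the variable `V`. -/
theorem Comp.to_inst {A C₀ : PreTy} {V : TVar} {σ : TVar → PreTy} (hV : V ∉ A.fv)
    (h : WF (.mu V.sort A)) (hσ : ClosedSubst σ) (hσA : ∀ X ∈ A.fv, σ X = .fvar X)
    (hC : Comp (A.openVar V) C₀) : Comp (inst V.sort A (σ V)) (C₀.subst σ) := by
  rw [inst_eq_subst_openVar hσ hσA]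
  refine hC.subst hσ (hC.subst_self ?_)
  rintro X rfl
  refine hσA X ((mem_fv_openVar (hC.fv_subset (by simp [fv]))).resolve_right ?_)
  rintro rfl
  exact hC.not_openVar hV h

/-- If opening does not introduce the variable, then the bound variable does not occur. -/
theorem instAt_congr_of_notMem {k : VSort} {V : TVar} {A : PreTy} (u u' : PreTy) :
    ∀ {n}, V ∉ (instAt k (.fvar V) n A).fv → instAt k u n A = instAt k u' n A := by
  induction A with
  | bvar k' i =>
    intro n h
    simp only [instAt] at h ⊢
    split_ifs with hc
    · simp [hc, fv] at h
    · rfl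
  | mu k' A ih => exact fun h => congrArg _ (ih h)
  | fvar W => exact fun _ => rfl
  | const c => exact fun _ => rfl
  | _ A B ihA ihB =>
    intro n h
    simp only [instAt, fv, Finset.mem_union, not_or] at h ⊢
    rw [ihA h.1, ihB h.2]

end PreTy

open PreTy

/-! ### Properties of type equivalence -/

theorem EqMu.wf {A B : PreTy} (h : EqMu A B) : WF A ∧ WF B := by
  induction h with
  | refl h => exact ⟨h, h⟩
  | trans _ _ ih1 ih2 => exact ⟨ih1.1, ih2.2⟩
  | symm _ ih => exact ih.symm
  | comp hD hD' _ _ ih1 ih2 => exact ⟨ih1.1.app hD ih2.1, ih1.2.app hD' ih2.2⟩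
  | func _ _ ih1 ih2 => exact ⟨ih1.1.fn ih2.1, ih1.2.fn ih2.2⟩
  | unionIdem h => exact ⟨h.union h, h⟩
  | unionComm h1 h2 => exact ⟨h1.union h2, h2.union h1⟩
  | unionAssoc h1 h2 h3 => exact ⟨h1.union (h2.union h3), (h1.union h2).union h3⟩
  | union _ _ ih1 ih2 => exact ⟨ih1.1.union ih2.1, ih1.2.union ih2.2⟩
  | recur V _ _ h1 h2 _ _ => exact ⟨h1, h2⟩
  | fold h => exact ⟨h, h.unfold⟩
  | contr h _ _ ih => exact ⟨ih.1, h⟩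

theorem EqMu.subst {A B : PreTy} (h : EqMu A B) : ∀ {σ : TVar → PreTy}, SortedSubst σ →
    EqMu (A.subst σ) (B.subst σ) := by
  induction h with
  | refl h => exact fun hσ => .refl (h.subst hσ)
  | trans _ _ ih1 ih2 => exact fun hσ => .trans (ih1 hσ) (ih2 hσ)
  | symm _ ih => exact fun hσ => .symm (ih hσ)
  | comp hD hD' _ _ ih1 ih2 =>
    exact fun hσ => .comp (HasSort.subst hσ hD) (HasSort.subst hσ hD') (ih1 hσ) (ih2 hσ)
  | func _ _ ih1 ih2 => exact fun hσ => .func (ih1 hσ) (ih2 hσ)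
  | unionIdem h => exact fun hσ => .unionIdem (h.subst hσ)
  | unionComm h1 h2 => exact fun hσ => .unionComm (h1.subst hσ) (h2.subst hσ)
  | unionAssoc h1 h2 h3 =>
    exact fun hσ => .unionAssoc (h1.subst hσ) (h2.subst hσ) (h3.subst hσ)
  | union _ _ ih1 ih2 => exact fun hσ => .union (ih1 hσ) (ih2 hσ)
  | @recur A B V hA hB h1 h2 _ ih =>
    intro σ hσ
    -- The images under `σ` may mention `V`, so the binder is reopened with a fresh name of the same
    -- sort.
    obtain ⟨V', hs, hV'⟩ := TVar.exists_fresh V.sort ((A.subst σ).fv ∪ (B.subst σ).fv)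
    simp only [Finset.mem_union, not_or] at hV'
    have := ih (hσ.update_fvar hs)
    rw [subst_update_openVar_fvar hσ.closed hA hs, subst_update_openVar_fvar hσ.closed hB hs] at this
    have h1' := h1.subst hσ
    have h2' := h2.subst hσ
    simp only [PreTy.subst, ← hs] at h1' h2' ⊢
    exact .recur V' hV'.1 hV'.2 h1' h2' this
  | @fold k A h =>
    intro σ hσ
    rw [subst_inst hσ.closed]
    exact .fold (h.subst hσ)
  | contr h hk _ ih =>
    intro σ hσ
    have := ih hσ
    rw [subst_inst hσ.closed] at this
    exact .contr (h.subst hσ) (fun e => HasSort.subst hσ (hk e)) this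

/-- The number of inner nodes. -/
def PreTy.size : PreTy → ℕ
  | app A B => size A + size B + 1
  | fn A B => size A + size B + 1
  | union A B => size A + size B + 1
  | mu _ A => size A + 1
  | _ => 0

theorem PreTy.size_openVar (A : PreTy) (V : TVar) : (A.openVar V).size = A.size := by
  suffices ∀ n, size (instAt V.sort (fvar V) n A) = size A from this 0
  induction A with
  | bvar k i => intro n; simp only [instAt]; split_ifs <;> rfl
  | _ => intro n; simp_all [instAt, size]

/-- Equivalent types may be substituted in a type. -/
theorem EqMu.congr_subst {T : PreTy} {σ τ : TVar → PreTy} (h : ∀ X, EqMu (σ X) (τ X))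
    (hσ : WF (T.subst σ)) (hτ : WF (T.subst τ)) : EqMu (T.subst σ) (T.subst τ) := by
  -- Induction is on size, because the opened body of a binder is not a subterm but has the size of
  -- the body.
  generalize hn : T.size = n
  induction n using Nat.strong_induction_on generalizing T σ τ with
  | _ n ih =>
    subst hn
    cases T with
    | bvar k i => exact .refl hσ
    | fvar V => exact h V
    | const c => exact .refl hσ
    | app A B =>
      exact .comp hσ.app_left.2 hτ.app_left.2
        (ih _ (by simp only [size]; omega) h hσ.app_left.1 hτ.app_left.1 rfl)
        (ih _ (by simp only [size]; omega) h hσ.app_right hτ.app_right rfl)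
    | fn A B =>
      exact .func (ih _ (by simp only [size]; omega) h hσ.fn_left hτ.fn_left rfl)
        (ih _ (by simp only [size]; omega) h hσ.fn_right hτ.fn_right rfl)
    | union A B =>
      exact .union (ih _ (by simp only [size]; omega) h hσ.union_left hτ.union_left rfl)
        (ih _ (by simp only [size]; omega) h hσ.union_right hτ.union_right rfl)
    | mu k A =>
      obtain ⟨V, rfl, hV⟩ := TVar.exists_fresh k (A.fv ∪ (A.subst σ).fv ∪ (A.subst τ).fv)
      simp only [Finset.mem_union, not_or] at hV
      refine .recur V hV.1.2 hV.2 hσ hτ ?_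
      have e1 := subst_update_openVar_fvar (W := V) (fun X => (h X).wf.1.closed) hV.1.1 rfl
      have e2 := subst_update_openVar_fvar (W := V) (fun X => (h X).wf.2.closed) hV.1.1 rfl
      rw [← e1, ← e2]
      refine ih _ (by simp only [size]; omega) (fun X => ?_) ?_ ?_ (size_openVar A V)
      · by_cases hX : X = V
        · subst hX; simpa using EqMu.refl (WF.fvar X)
        · simpa [Function.update_of_ne hX] using h X
      · rw [e1]; exact WF.openVar hσ
      · rw [e2]; exact WF.openVar hτ

/-! ### Matching of components -/

/-- Components with the same root; variables are related by `v`, the arguments of `⊃` by `R`. -/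
inductive CompRel (v : TVar → TVar → Prop) (R : PreTy → PreTy → Prop) : PreTy → PreTy → Prop
  | fvar {X Y} : v X Y → CompRel v R (fvar X) (fvar Y)
  | const (c) : CompRel v R (const c) (const c)
  | app (A B A' B') : CompRel v R (app A B) (app A' B')
  | fn {A B A' B'} : R A' A → R B B' → CompRel v R (fn A B) (fn A' B')

/-- Every component of `A` is related to a component of `B`. -/
def CompSim (v : TVar → TVar → Prop) (R : PreTy → PreTy → Prop) (A B : PreTy) : Prop :=
  ∀ C, Comp A C → ∃ C', Comp B C' ∧ CompRel v R C C'

section CompSim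

variable {v : TVar → TVar → Prop} {R : PreTy → PreTy → Prop} {A B C : PreTy}

theorem CompSim.mono {v' : TVar → TVar → Prop} {R' : PreTy → PreTy → Prop}
    (hv : ∀ X Y, v X Y → v' X Y) (hR : ∀ A B, R A B → R' A B) (h : CompSim v R A B) :
    CompSim v' R' A B := by
  intro C hC
  obtain ⟨C', h1, h2⟩ := h C hC
  refine ⟨C', h1, ?_⟩
  cases h2 with
  | fvar h => exact .fvar (hv _ _ h)
  | const c => exact .const c
  | app => exact .app _ _ _ _
  | fn h3 h4 => exact .fn (hR _ _ h3) (hR _ _ h4)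

theorem CompRel.refl_of_comp (hv : ∀ X, v X X) (hR : ∀ A, WF A → R A A) (hA : WF A)
    (h : Comp A C) : CompRel v R C C := by
  induction h with
  | fvar V => exact .fvar (hv V)
  | const c => exact .const c
  | app A B => exact .app _ _ _ _
  | fn A B => exact .fn (hR _ hA.fn_left) (hR _ hA.fn_right)
  | unionL _ ih => exact ih hA.union_left
  | unionR _ ih => exact ih hA.union_right
  | mu _ ih => exact ih hA.unfold

theorem CompSim.of_comp (hv : ∀ X, v X X) (hR : ∀ A, WF A → R A A) (hA : WF A)
    (h : ∀ C, Comp A C → Comp B C) : CompSim v R A B :=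
  fun C hC => ⟨C, h C hC, .refl_of_comp hv hR hA hC⟩

theorem CompSim.trans (hv : ∀ X Y Z, v X Y → v Y Z → v X Z)
    (hR : ∀ A B C, R A B → R B C → R A C) (h1 : CompSim v R A B) (h2 : CompSim v R B C) :
    CompSim v R A C := by
  intro D hD
  obtain ⟨D', h, hr⟩ := h1 D hD
  obtain ⟨D'', h', hr'⟩ := h2 D' h
  refine ⟨D'', h', ?_⟩
  cases hr with
  | fvar a => cases hr' with | fvar a' => exact .fvar (hv _ _ _ a a')
  | const c => exact hr'
  | app => cases hr'; exact .app _ _ _ _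
  | fn a b => cases hr' with | fn a' b' => exact .fn (hR _ _ _ a' a) (hR _ _ _ b b')

theorem CompSim.union_left (h1 : CompSim v R A C) (h2 : CompSim v R B C) :
    CompSim v R (union A B) C := by
  intro D hD
  cases hD with
  | unionL h => exact h1 D h
  | unionR h => exact h2 D h

theorem CompSim.union_right1 (h : CompSim v R A B) : CompSim v R A (union B C) := fun D hD =>
  let ⟨D', h1, h2⟩ := h D hD; ⟨D', .unionL h1, h2⟩

theorem CompSim.union_right2 (h : CompSim v R A C) : CompSim v R A (union B C) := fun D hD =>
  let ⟨D', h1, h2⟩ := h D hD; ⟨D', .unionR h1, h2⟩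

theorem CompSim.mu_iff {k l : VSort} : CompSim v R (mu k A) (mu l B) ↔
    CompSim v R (inst k A (mu k A)) (inst l B (mu l B)) := by
  constructor
  · intro h C hC
    obtain ⟨C', h1, h2⟩ := h C (.mu hC)
    cases h1 with | mu h1 => exact ⟨C', h1, h2⟩
  · intro h C hC
    cases hC with | mu hC =>
    obtain ⟨C', h1, h2⟩ := h C hC
    exact ⟨C', .mu h1, h2⟩

/-- By contractiveness the components on both sides come from the opened bodies. Variable components
are fixed by `σ`; the substitution is felt only inside arrow arguments, where `hR` takes care of it.
-/
theorem CompSim.inst_openVar {v' : TVar → TVar → Prop} {R' : PreTy → PreTy → Prop} {V W : TVar}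
    {σ : TVar → PreTy} (hσ : ClosedSubst σ) (hV : V ∉ A.fv) (hW : W ∉ B.fv)
    (hA : WF (mu V.sort A)) (hB : WF (mu W.sort B))
    (hσA : ∀ X ∈ A.fv, σ X = fvar X) (hσB : ∀ X ∈ B.fv, σ X = fvar X)
    (hv : ∀ X Y, X ∈ A.fv → v X Y → v' X Y)
    (hR : ∀ P Q, R P Q → R' (P.subst σ) (Q.subst σ))
    (h : CompSim v R (A.openVar V) (B.openVar W)) :
    CompSim v' R' (inst V.sort A (σ V)) (inst W.sort B (σ W)) := by
  intro C hC
  obtain ⟨C₀, h1, h2, rfl⟩ := hC.of_inst hV hA hσ hσA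
  obtain ⟨C₀', h3, h4⟩ := h C₀ h1
  refine ⟨_, h3.to_inst hW hB hσ hσB, ?_⟩
  cases h4 with
  | @fvar X Y h =>
    have hY : Y ∈ B.fv := by
      refine (mem_fv_openVar (h3.fv_subset (by simp [fv]))).resolve_right ?_
      rintro rfl
      exact h3.not_openVar hW hB
    simp only [PreTy.subst]
    rw [hσA X (h2 X rfl), hσB Y hY]
    exact .fvar (hv _ _ (h2 X rfl) h)
  | const c => exact .const c
  | app => exact .app _ _ _ _
  | fn a b => exact .fn (hR _ _ a) (hR _ _ b)

end CompSim

/-- Both instances have the same components up to replacing `u` by `w` inside them, and arrow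
arguments stay equivalent by congruence. Well-formedness of the instances is assumed because `u` and
`w` need not have the sort of the binder, as in the rule `contr`. -/
theorem CompSim.inst_congr {k : VSort} {B u w : PreTy} (hB : WF (mu k B)) (huw : EqMu u w)
    (hu : WF (inst k B u)) (hw : WF (inst k B w)) :
    CompSim Eq EqMu (inst k B u) (inst k B w) := by
  obtain ⟨V, rfl, hV⟩ := TVar.exists_fresh k B.fv
  set σ := Function.update fvar V u with hσ
  set τ := Function.update fvar V w with hτ
  have hσc : ClosedSubst σ := ClosedSubst.fvar.update V huw.wf.1.closed
  have hτc : ClosedSubst τ := ClosedSubst.fvar.update V huw.wf.2.closed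
  have hσB : ∀ X ∈ B.fv, σ X = fvar X := fun X hX =>
    Function.update_of_ne (by rintro rfl; exact hV hX) _ _
  have hτB : ∀ X ∈ B.fv, τ X = fvar X := fun X hX =>
    Function.update_of_ne (by rintro rfl; exact hV hX) _ _
  have hστ : ∀ X, EqMu (σ X) (τ X) := by
    intro X
    by_cases hX : X = V
    · subst hX; simpa [hσ, hτ] using huw
    · simpa [hσ, hτ, Function.update_of_ne hX] using EqMu.refl (WF.fvar X)
  rw [show u = σ V by simp [hσ]] at hu ⊢
  rw [show w = τ V by simp [hτ]] at hw ⊢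
  intro C hC
  obtain ⟨C₀, h1, h2, rfl⟩ := hC.of_inst hV hB hσc hσB
  have hC' := h1.to_inst hV hB hτc hτB
  refine ⟨_, hC', ?_⟩
  have w1 := hC.wf hu
  have w2 := hC'.wf hw
  clear hC hC'
  cases hc : C₀ with
  | fvar X =>
    simp only [PreTy.subst]
    rw [hσB X (h2 X hc), hτB X (h2 X hc)]
    exact .fvar rfl
  | const c => exact .const c
  | app => exact .app _ _ _ _
  | fn P Q =>
    subst hc
    exact .fn (.symm (.congr_subst hστ w1.fn_left w2.fn_left))
      (.congr_subst hστ w1.fn_right w2.fn_right)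
  | bvar k i => subst hc; exact absurd w1.closed (Nat.not_lt_zero _)
  | union P Q => subst hc; exact absurd rfl (h1.ne_union P Q)
  | mu l P => subst hc; exact absurd rfl (h1.ne_mu l P)

theorem CompSim.eqMu_trans {A B C : PreTy} (h1 : CompSim Eq EqMu A B) (h2 : CompSim Eq EqMu B C) :
    CompSim Eq EqMu A C :=
  h1.trans (fun _ _ _ => Eq.trans) (fun _ _ _ => EqMu.trans) h2

theorem CompSim.eqMu_of_comp {A B : PreTy} (hA : WF A) (h : ∀ C, Comp A C → Comp B C) :
    CompSim Eq EqMu A B :=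
  .of_comp (fun _ => rfl) (fun _ => .refl) hA h

/-- Both bodies are first instantiated with the left recursive type; then, in the right body, it is
exchanged for the equivalent right one. -/
theorem CompSim.eqMu_mu {A B : PreTy} {V : TVar} (hA : V ∉ A.fv) (hB : V ∉ B.fv)
    (h1 : WF (mu V.sort A)) (h2 : WF (mu V.sort B)) (h : EqMu (mu V.sort A) (mu V.sort B))
    (hs : CompSim Eq EqMu (A.openVar V) (B.openVar V)) :
    CompSim Eq EqMu (mu V.sort A) (mu V.sort B) := by
  rw [CompSim.mu_iff]
  have hσ := SortedSubst.fvar.update (V := V) h1 h1.sorted.mu_data_iff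
  have key := hs.inst_openVar (v' := Eq) (R' := EqMu) hσ.closed hA hB h1 h2
    (fun X hX => Function.update_of_ne (by rintro rfl; exact hA hX) _ _)
    (fun X hX => Function.update_of_ne (by rintro rfl; exact hB hX) _ _)
    (fun _ _ _ h => h) (fun _ _ h => h.subst hσ)
  rw [Function.update_self] at key
  exact key.eqMu_trans (.inst_congr h2 h (h2.inst h1 h1.sorted.mu_data_iff) h2.unfold)

/-- Both directions are proved together because symmetry exchanges them. -/
theorem EqMu.compSim {A B : PreTy} (h : EqMu A B) :
    CompSim Eq EqMu A B ∧ CompSim Eq EqMu B A := by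
  induction h with
  | refl h => exact ⟨.eqMu_of_comp h fun _ h => h, .eqMu_of_comp h fun _ h => h⟩
  | trans _ _ ih1 ih2 => exact ⟨ih1.1.eqMu_trans ih2.1, ih2.2.eqMu_trans ih1.2⟩
  | symm _ ih => exact ih.symm
  | comp =>
    constructor <;> (rintro C ⟨⟩; exact ⟨_, .app _ _, .app _ _ _ _⟩)
  | func h1 h2 =>
    constructor <;> rintro C ⟨⟩
    · exact ⟨_, .fn _ _, .fn h1.symm h2⟩
    · exact ⟨_, .fn _ _, .fn h1 h2.symm⟩
  | unionIdem h =>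
    refine ⟨.eqMu_of_comp (h.union h) ?_, .eqMu_of_comp h fun _ h => .unionL h⟩
    rintro C (h | h)
    exacts [‹_›, ‹_›]
  | unionComm h1 h2 =>
    refine ⟨.eqMu_of_comp (h1.union h2) ?_, .eqMu_of_comp (h2.union h1) ?_⟩
    all_goals
      intro C h
      cases h
      · exact .unionR ‹_›
      · exact .unionL ‹_›
  | unionAssoc h1 h2 h3 =>
    refine ⟨.eqMu_of_comp (h1.union (h2.union h3)) ?_, .eqMu_of_comp ((h1.union h2).union h3) ?_⟩
    · intro C h
      cases h with
      | unionL h => exact .unionL (.unionL h)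
      | unionR h =>
        cases h with
        | unionL h => exact .unionL (.unionR h)
        | unionR h => exact .unionR h
    · intro C h
      cases h with
      | unionR h => exact .unionR (.unionR h)
      | unionL h =>
        cases h with
        | unionL h => exact .unionL h
        | unionR h => exact .unionR (.unionL h)
  | union _ _ ih1 ih2 =>
    exact ⟨ih1.1.union_right1.union_left ih2.1.union_right2,
      ih1.2.union_right1.union_left ih2.2.union_right2⟩
  | recur V hA hB h1 h2 h ih =>
    exact ⟨.eqMu_mu hA hB h1 h2 (.recur V hA hB h1 h2 h) ih.1,
      .eqMu_mu hB hA h2 h1 (.symm (.recur V hA hB h1 h2 h)) ih.2⟩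
  | fold h =>
    refine ⟨.eqMu_of_comp h ?_, .eqMu_of_comp h.unfold fun _ h => .mu h⟩
    intro C h
    cases h
    assumption
  | @contr k A B hB hk h ih =>
    -- The equivalence being derived may itself be used: it is needed only for arrow arguments,
    -- which are compared by `EqMu` and not by the induction hypothesis.
    have h' : EqMu A (mu k B) := .contr hB hk h
    constructor
    · refine (ih.1.eqMu_trans (.inst_congr hB h' h.wf.2 hB.unfold)).eqMu_trans ?_
      exact .eqMu_of_comp hB.unfold fun _ h => .mu h
    · refine CompSim.eqMu_trans ?_
        ((CompSim.inst_congr hB h'.symm hB.unfold h.wf.2).eqMu_trans ih.2)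
      refine .eqMu_of_comp hB ?_
      intro C h
      cases h
      assumption

/-! ### Properties of subtyping -/

theorem SubMu.wf {S : List (TVar × TVar)} {A B : PreTy} (h : SubMu S A B) : WF A ∧ WF B := by
  induction h with
  | refl h => exact ⟨h, h⟩
  | hyp _ => exact ⟨WF.fvar _, WF.fvar _⟩
  | eq h => exact h.wf
  | trans _ _ ih1 ih2 => exact ⟨ih1.1, ih2.2⟩
  | comp hD hD' _ _ ih1 ih2 => exact ⟨ih1.1.app hD ih2.1, ih1.2.app hD' ih2.2⟩
  | func _ _ ih1 ih2 => exact ⟨ih1.2.fn ih2.1, ih1.1.fn ih2.2⟩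
  | unionL _ _ ih1 ih2 => exact ⟨ih1.1.union ih2.1, ih1.2⟩
  | unionR1 h _ ih => exact ⟨ih.1, ih.2.union h⟩
  | unionR2 h _ ih => exact ⟨ih.1, h.union ih.2⟩
  | recur V W _ _ _ _ _ h1 h2 _ _ => exact ⟨h1, h2⟩

/-- Fresh names for the variables `V` and `W` of a `recur` step. -/
theorem exists_fresh_pair (V W : TVar) (F : Finset TVar) :
    ∃ V' W' : TVar, V'.sort = V.sort ∧ W'.sort = W.sort ∧ V' ∉ F ∧ W' ∉ F ∧
      (V' = W' ↔ V = W) := by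
  obtain ⟨V', hV, hV'⟩ := TVar.exists_fresh V.sort F
  by_cases h : V = W
  · subst h
    exact ⟨V', V', hV, hV, hV', hV', by simp⟩
  · obtain ⟨W', hW, hW'⟩ := TVar.exists_fresh W.sort (insert V' F)
    simp only [Finset.mem_insert, not_or] at hW'
    exact ⟨V', W', hV, hW, hV', hW'.2, by simp [h, Ne.symm hW'.1]⟩

/-- The variables in a list of assumptions. -/
def asmVars (S : List (TVar × TVar)) : Finset TVar :=
  (S.map Prod.fst).toFinset ∪ (S.map Prod.snd).toFinset

theorem fresh_of_notMem_asmVars {S : List (TVar × TVar)} {V : TVar} (h : V ∉ asmVars S)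
    {p : TVar × TVar} (hp : p ∈ S) : p.1 ≠ V ∧ p.2 ≠ V := by
  constructor <;> rintro rfl <;> apply h <;> simp only [asmVars, Finset.mem_union, List.mem_toFinset]
  · exact .inl (List.mem_map_of_mem hp)
  · exact .inr (List.mem_map_of_mem hp)

/-- Substitution, given a way to extend the substitution to the assumption of a `recur` step. -/
theorem SubMu.subst_aux (Q : (TVar → PreTy) → List (TVar × TVar) → List (TVar × TVar) → Prop)
    (hyp : ∀ {σ S S'}, Q σ S S' → ∀ {V W}, (V, W) ∈ S → SubMu S' (σ V) (σ W))
    (ext : ∀ {σ S S'}, Q σ S S' → ∀ {V W V' W' : TVar}, V'.sort = V.sort → W'.sort = W.sort →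
      (V' = W' ↔ V = W) → (∀ p ∈ S, p.1 ≠ V ∧ p.1 ≠ W ∧ p.2 ≠ V ∧ p.2 ≠ W) →
      V' ∉ asmVars S' → W' ∉ asmVars S' →
      Q (Function.update (Function.update σ V (fvar V')) W (fvar W'))
        ((V, W) :: S) ((V', W') :: S'))
    {S : List (TVar × TVar)} {A B : PreTy} (h : SubMu S A B) :
    ∀ {σ S'}, SortedSubst σ → Q σ S S' → SubMu S' (A.subst σ) (B.subst σ) := by
  induction h with
  | refl h => exact fun hσ _ => .refl (h.subst hσ)
  | hyp h => exact fun _ hQ => hyp hQ h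
  | eq h => exact fun hσ _ => .eq (h.subst hσ)
  | trans _ _ ih1 ih2 => exact fun hσ hQ => .trans (ih1 hσ hQ) (ih2 hσ hQ)
  | comp hD hD' _ _ ih1 ih2 =>
    exact fun hσ hQ =>
      .comp (HasSort.subst hσ hD) (HasSort.subst hσ hD') (ih1 hσ hQ) (ih2 hσ hQ)
  | func _ _ ih1 ih2 => exact fun hσ hQ => .func (ih1 hσ hQ) (ih2 hσ hQ)
  | unionL _ _ ih1 ih2 => exact fun hσ hQ => .unionL (ih1 hσ hQ) (ih2 hσ hQ)
  | unionR1 h _ ih => exact fun hσ hQ => .unionR1 (h.subst hσ) (ih hσ hQ)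
  | unionR2 h _ ih => exact fun hσ hQ => .unionR2 (h.subst hσ) (ih hσ hQ)
  | @recur S A B V W hVA hWB hWA hVB hS hA hB h ih =>
    intro σ S' hσ hQ
    -- The names `V` and `W` may coincide, and the fresh names must then coincide too; otherwise the
    -- later update at `W` would override the one at `V`.
    obtain ⟨V', W', hsV, hsW, hV', hW', hVW⟩ := exists_fresh_pair V W
      ((A.subst σ).fv ∪ (B.subst σ).fv ∪ asmVars S')
    simp only [Finset.mem_union, not_or] at hV' hW'
    have hσ' : SortedSubst (Function.update σ V (fvar V')) := hσ.update_fvar hsV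
    have key := ih (hσ'.update_fvar (V := W) hsW) (ext hQ hsV hsW hVW hS hV'.2 hW'.2)
    have eA : (A.openVar V).subst (Function.update (Function.update σ V (fvar V')) W (fvar W'))
        = (A.subst σ).openVar V' := by
      rw [subst_update_of_notMem hWA, subst_update_openVar_fvar hσ.closed hVA hsV]
    have eB : (B.openVar W).subst (Function.update (Function.update σ V (fvar V')) W (fvar W'))
        = (B.subst σ).openVar W' := by
      rw [subst_update_openVar_fvar hσ'.closed hWB hsW,
        subst_update_of_notMem fun h => hVB (subset_fv_openVar _ _ h)]
    rw [eA, eB] at key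
    have hA' := hA.subst hσ
    have hB' := hB.subst hσ
    simp only [PreTy.subst, ← hsV, ← hsW] at hA' hB' ⊢
    refine .recur V' W' hV'.1.1 hW'.1.2 ?_ ?_ (fun p hp => ?_) hA' hB' key
    -- An occurrence of `W'` would come either from the image of `V`, forcing `V = W` against
    -- freshness, or from `σ`, where `W'` is fresh.
    · rw [← eA, mem_fv_subst]
      rintro ⟨X, hX, hXW⟩
      have hXW' : X ≠ W := fun e => hWA (e ▸ hX)
      rw [Function.update_of_ne hXW'] at hXW
      by_cases hXV : X = V
      · subst hXV
        rw [Function.update_self] at hXW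
        exact hXW' (hVW.1 (Finset.mem_singleton.1 hXW).symm)
      · rw [Function.update_of_ne hXV] at hXW
        exact hW'.1.1 (mem_fv_subst.2 ⟨X, (mem_fv_openVar hX).resolve_right hXV, hXW⟩)
    · rw [← eB, mem_fv_subst]
      rintro ⟨X, hX, hXV⟩
      have hXV' : X ≠ V := fun e => hVB (e ▸ hX)
      by_cases hXW : X = W
      · subst hXW
        rw [Function.update_self] at hXV
        exact hXV' (hVW.1 (Finset.mem_singleton.1 hXV)).symm
      · rw [Function.update_of_ne hXW, Function.update_of_ne hXV'] at hXV
        exact hV'.1.2 (mem_fv_subst.2 ⟨X, (mem_fv_openVar hX).resolve_right hXW, hXV⟩)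
    · exact ⟨(fresh_of_notMem_asmVars hV'.2 hp).1, (fresh_of_notMem_asmVars hW'.2 hp).1,
        (fresh_of_notMem_asmVars hV'.2 hp).2, (fresh_of_notMem_asmVars hW'.2 hp).2⟩

/-- The added assumptions may use the names of a `recur` step, so these must be renamed. This is
`SubMu.subst_aux` for renamings; it has to come before general substitution, which weakens
derivations when passing a binder. -/
theorem SubMu.weaken {S S' : List (TVar × TVar)} {A B : PreTy} (h : SubMu S A B) (hS : S ⊆ S') :
    SubMu S' A B := by
  have := h.subst_aux (fun σ S S' => ∃ ρ : TVar → TVar, (∀ V, σ V = fvar (ρ V)) ∧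
    ∀ V W, (V, W) ∈ S → (ρ V, ρ W) ∈ S') ?_ ?_ SortedSubst.fvar ⟨id, fun _ => rfl, fun _ _ h => hS h⟩
  · rwa [subst_fvar, subst_fvar] at this
  · rintro σ S S' ⟨ρ, h1, h2⟩ V W h
    rw [h1, h1]
    exact .hyp (h2 _ _ h)
  · rintro σ S S' ⟨ρ, h1, h2⟩ V W V' W' _ _ hVW hS _ _
    refine ⟨Function.update (Function.update ρ V V') W W', fun X => ?_, fun X Y hXY => ?_⟩
    · simp only [Function.update_apply]
      split_ifs <;> simp [h1]
    · rcases List.mem_cons.1 hXY with e | hXY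
      · obtain ⟨rfl, rfl⟩ := Prod.mk.inj e
        simp only [Function.update_self, List.mem_cons]
        left
        by_cases e : X = Y
        · subst e; simp [hVW.2]
        · simp [Function.update_of_ne e]
      · obtain ⟨a, b, c, d⟩ := hS _ hXY
        simp only [Function.update_of_ne a, Function.update_of_ne b, Function.update_of_ne c,
          Function.update_of_ne d]
        exact .tail _ (h2 _ _ hXY)

theorem SubMu.subst {S S' : List (TVar × TVar)} {A B : PreTy} (h : SubMu S A B)
    {σ : TVar → PreTy} (hσ : SortedSubst σ)
    (hS : ∀ V W, (V, W) ∈ S → SubMu S' (σ V) (σ W)) : SubMu S' (A.subst σ) (B.subst σ) := by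
  refine h.subst_aux (fun σ S S' => ∀ V W, (V, W) ∈ S → SubMu S' (σ V) (σ W))
    (fun hQ _ _ h => hQ _ _ h) ?_ hσ hS
  intro σ S S' hQ V W V' W' _ _ hVW hS _ _ X Y hXY
  rcases List.mem_cons.1 hXY with e | hXY
  · obtain ⟨rfl, rfl⟩ := Prod.mk.inj e
    have : Function.update (Function.update σ X (fvar V')) Y (fvar W') X = fvar V' := by
      by_cases e : X = Y
      · subst e; simp [hVW.2]
      · simp [Function.update_of_ne e]
    rw [this, Function.update_self]
    exact .hyp (.head _)
  · obtain ⟨a, b, c, d⟩ := hS _ hXY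
    simp only [Function.update_of_ne a, Function.update_of_ne b, Function.update_of_ne c,
      Function.update_of_ne d]
    exact (hQ _ _ hXY).weaken (List.subset_cons_self _ _)

/-- The variable inequalities that follow from the assumptions. -/
def AsmLE (S : List (TVar × TVar)) : TVar → TVar → Prop :=
  Relation.ReflTransGen fun X Y => (X, Y) ∈ S

/-- The new assumption can only be used from `V`, and no assumption in `S` leads to `V`; a chain
starting elsewhere never gets there. -/
theorem AsmLE.strengthen {S : List (TVar × TVar)} {V W X Y : TVar}
    (hS : ∀ p ∈ S, p.1 ≠ V ∧ p.1 ≠ W ∧ p.2 ≠ V ∧ p.2 ≠ W) (hX : X ≠ V)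
    (h : AsmLE ((V, W) :: S) X Y) : AsmLE S X Y ∧ Y ≠ V := by
  induction h with
  | refl => exact ⟨.refl, hX⟩
  | @tail Y Z _ h ih =>
    rcases List.mem_cons.1 h with e | h
    · exact absurd (Prod.mk.inj e).1 ih.2
    · exact ⟨ih.1.tail h, (hS _ h).2.2.1⟩

/-- Inversion of subtyping: the components of the smaller type are matched by components of
the larger one. -/
theorem SubMu.compSim {S : List (TVar × TVar)} {A B : PreTy} (h : SubMu S A B) :
    CompSim (AsmLE S) (SubMu S) A B := by
  induction h with
  | refl h => exact .of_comp (fun _ => .refl) (fun _ => .refl) h fun _ h => h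
  | hyp h =>
    rintro C ⟨⟩
    exact ⟨_, .fvar _, .fvar (.single h)⟩
  | eq h =>
    exact h.compSim.1.mono (fun _ _ e => by rw [e]; exact .refl) fun _ _ h => .eq h
  | trans _ _ ih1 ih2 =>
    exact ih1.trans (fun _ _ _ => Relation.ReflTransGen.trans) (fun _ _ _ => .trans) ih2
  | comp => rintro C ⟨⟩; exact ⟨_, .app _ _, .app _ _ _ _⟩
  | func h1 h2 => rintro C ⟨⟩; exact ⟨_, .fn _ _, .fn h1 h2⟩
  | unionL _ _ ih1 ih2 => exact ih1.union_left ih2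
  | unionR1 _ _ ih => exact ih.union_right1
  | unionR2 _ _ ih => exact ih.union_right2
  | @recur S A B V W hVA hWB hWA hVB hS hA hB h ih =>
    have hsub : SubMu S (mu V.sort A) (mu W.sort B) := .recur V W hVA hWB hWA hVB hS hA hB h
    have hWA' : W ∉ A.fv := fun h => hWA (subset_fv_openVar _ _ h)
    have hVB' : V ∉ B.fv := fun h => hVB (subset_fv_openVar _ _ h)
    -- Substituting the recursive types for the bound names turns the assumption `V ⪯ W` into the
    -- conclusion of the rule, which is already derivable.
    set σ := Function.update (Function.update fvar V (mu V.sort A)) W (mu W.sort B) with hσ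
    have hσs : SortedSubst σ := (SortedSubst.fvar.update hA hA.sorted.mu_data_iff).update hB
      hB.sorted.mu_data_iff
    have hσid : ∀ X, X ≠ V → X ≠ W → σ X = fvar X := fun X h1 h2 => by
      rw [hσ, Function.update_of_ne h2, Function.update_of_ne h1]
    have hσW : σ W = mu W.sort B := Function.update_self _ _ _
    have hσV : V ≠ W → σ V = mu V.sort A := fun e => by
      rw [hσ, Function.update_of_ne e, Function.update_self]
    have key := ih.inst_openVar (v' := AsmLE S) (R' := SubMu S) hσs.closed hVA hWB hA hB
      (fun X hX => hσid X (fun e => hVA (e ▸ hX)) (fun e => hWA' (e ▸ hX)))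
      (fun X hX => hσid X (fun e => hVB' (e ▸ hX)) (fun e => hWB (e ▸ hX)))
      (fun X Y hX hXY => (hXY.strengthen hS fun e => hVA (e ▸ hX)).1)
      (fun P Q hPQ => hPQ.subst hσs fun X Y hXY => by
        rcases List.mem_cons.1 hXY with e | hXY
        · obtain ⟨rfl, rfl⟩ := Prod.mk.inj e
          by_cases e : X = Y
          · subst e; exact .refl (hσs X).1
          · rw [hσW, hσV e]; exact hsub
        · obtain ⟨a, b, c, d⟩ := hS _ hXY
          rw [hσid X a b, hσid Y c d]
          exact .hyp hXY)
    rw [CompSim.mu_iff]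
    rw [hσW] at key
    -- If the names coincide, `σ` sends `V` to the right recursive type; but then the freshness
    -- condition says that the bound variable does not occur in `A`, so the instance is unaffected.
    by_cases e : V = W
    · subst e
      have : inst V.sort A (σ V) = inst V.sort A (mu V.sort A) :=
        instAt_congr_of_notMem _ _ hWA
      rwa [this] at key
    · rwa [hσV e] at key

/-! ### Finite unions and subtypes of function types -/

theorem SubMu.bigUnion_le {S : List (TVar × TVar)} {B : PreTy} :
    ∀ {n : ℕ} {A : Fin (n + 1) → PreTy}, (∀ i, SubMu S (A i) B) → SubMu S (bigUnion A) B
  | 0, _, h => h 0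
  | _ + 1, _, h => .unionL (SubMu.bigUnion_le fun i => h i.castSucc) (h (Fin.last _))

theorem SubMu.le_bigUnion {S : List (TVar × TVar)} :
    ∀ {n : ℕ} {A : Fin (n + 1) → PreTy}, (∀ i, WF (A i)) → ∀ i, SubMu S (A i) (bigUnion A)
  | 0, _, h, i => by rw [Fin.eq_zero i]; exact .refl (h 0)
  | _ + 1, _, h, i => by
    refine Fin.lastCases ?_ (fun j => ?_) i
    · exact .unionR2 (.bigUnion fun i => h i.castSucc) (.refl (h _))
    · exact .unionR1 (h _) (SubMu.le_bigUnion (fun i => h i.castSucc) j)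

theorem EqMu.bigUnion : ∀ {n : ℕ} {A B : Fin (n + 1) → PreTy}, (∀ i, EqMu (A i) (B i)) →
    EqMu (bigUnion A) (bigUnion B)
  | 0, _, _, h => h 0
  | _ + 1, _, _, h => .union (EqMu.bigUnion fun i => h i.castSucc) (h (Fin.last _))

/-- Reassociation moves the members of `G` over one at a time. The predicate `P` remembers what the
members are, namely components in the application. -/
theorem EqMu.exists_bigUnion_append {P : PreTy → Prop} (hP : ∀ A, P A → WF A) {n : ℕ}
    {F : Fin (n + 1) → PreTy} (hF : ∀ i, P (F i)) : ∀ {m : ℕ} {G : Fin (m + 1) → PreTy},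
      (∀ i, P (G i)) → ∃ (k : ℕ) (H : Fin (k + 1) → PreTy), (∀ i, P (H i)) ∧
        EqMu (.union (PreTy.bigUnion F) (PreTy.bigUnion G)) (PreTy.bigUnion H)
  | 0, G, hG => by
    refine ⟨n + 1, Fin.snoc (α := fun _ => PreTy) F (G 0), fun i => ?_, ?_⟩
    · refine Fin.lastCases ?_ (fun j => ?_) i
      · simpa using hG 0
      · simpa using hF j
    · simp only [PreTy.bigUnion, Fin.snoc_castSucc, Fin.snoc_last]
      exact .refl ((WF.bigUnion fun i => hP _ (hF i)).union (hP _ (hG 0)))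
  | m + 1, G, hG => by
    obtain ⟨k, H, hH, h⟩ := EqMu.exists_bigUnion_append hP hF fun i : Fin (m + 1) => hG i.castSucc
    refine ⟨k + 1, Fin.snoc (α := fun _ => PreTy) H (G (Fin.last _)), fun i => ?_, ?_⟩
    · refine Fin.lastCases ?_ (fun j => ?_) i
      · simpa using hG _
      · simpa using hH j
    · simp only [PreTy.bigUnion, Fin.snoc_castSucc, Fin.snoc_last]
      exact .trans (.unionAssoc (WF.bigUnion fun i => hP _ (hF i))
        (WF.bigUnion fun i => hP _ (hG i.castSucc)) (hP _ (hG _)))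
        (.union h (.refl (hP _ (hG _))))

/-- Every type is equivalent to the union of a finite family of its components. -/
theorem EqMu.exists_bigUnion_comp {A : PreTy} (h : WF A) :
    ∃ (n : ℕ) (F : Fin (n + 1) → PreTy), (∀ i, Comp A (F i)) ∧ EqMu A (PreTy.bigUnion F) := by
  induction A, h using WF.unfold_induction with
  | fvar V => exact ⟨0, fun _ => fvar V, fun _ => .fvar V, .refl (WF.fvar V)⟩
  | const c => exact ⟨0, fun _ => const c, fun _ => .const c, .refl (WF.const c)⟩
  | app A B h => exact ⟨0, fun _ => .app A B, fun _ => .app A B, .refl h⟩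
  | fn A B h => exact ⟨0, fun _ => .fn A B, fun _ => .fn A B, .refl h⟩
  | union A B hA hB ihA ihB =>
    obtain ⟨n, F, hF, eF⟩ := ihA
    obtain ⟨m, G, hG, eG⟩ := ihB
    obtain ⟨k, H, hH, eH⟩ := EqMu.exists_bigUnion_append
      (P := fun C => Comp (.union A B) C) (fun C hC => hC.wf (hA.union hB))
      (fun i => .unionL (hF i)) fun i => .unionR (hG i)
    exact ⟨k, H, hH, .trans (.union eF eG) eH⟩
  | mu k A h ih =>
    obtain ⟨n, F, hF, eF⟩ := ih
    exact ⟨n, F, fun i => .mu (hF i), .trans (.fold h) eF⟩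

/-- Subtypes of function types are unions of function types. -/
theorem SubMu.fn_inversion {R P Q : PreTy} (h : SubMu [] R (.fn P Q)) :
    ∃ (n : ℕ) (A B : Fin (n + 1) → PreTy), EqMu R (bigUnion fun i => .fn (A i) (B i)) ∧
      ∀ i, SubMu [] P (A i) ∧ SubMu [] (B i) Q := by
  obtain ⟨n, F, hF, eF⟩ := EqMu.exists_bigUnion_comp h.wf.1
  have key : ∀ i, ∃ A B, F i = .fn A B ∧ SubMu [] P A ∧ SubMu [] B Q := by
    intro i
    -- The only component of `P ⊃ Q` is itself, so whatever is matched with it is an arrow.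
    obtain ⟨C', h1, h2⟩ := h.compSim _ (hF i)
    cases h1
    generalize F i = C at h2
    cases h2 with
    | fn a b => exact ⟨_, _, rfl, a, b⟩
  choose A B h1 h2 using key
  exact ⟨n, A, B, by rwa [← funext h1], h2⟩

/-! ### Datatypes and subtyping -/

theorem PreTy.SpineData.of_comp {A : PreTy} (h : WF A) :
    (∀ C, Comp A C → SpineData C) → SpineData A := by
  induction A, h using WF.unfold_induction with
  | fvar V => exact fun h => h _ (.fvar V)
  | const c => exact fun _ => trivial
  | app A B _ => exact fun _ => trivial
  | fn A B _ => exact fun h => h _ (.fn A B)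
  | union A B hA hB ihA ihB =>
    exact fun h => ⟨ihA fun C hC => h C (.unionL hC), ihB fun C hC => h C (.unionR hC)⟩
  | mu k A h ih =>
    intro h'
    exact (SpineData.instAt_iff (h.sorted.mu_data_iff.trans h.sorted.data_iff) A 0).1
      (ih fun C hC => h' C (.mu hC))

/-- Unfolding substitutes a type of the binder's own sort, so it does not change `SpineData`.
Together with `SpineData.of_comp`, being a datatype is thus a property of the components. -/
theorem PreTy.SpineData.comp {A C : PreTy} (hC : Comp A C) :
    WF A → SpineData A → SpineData C := by
  induction hC with
  | unionL _ ih => exact fun h h' => ih h.union_left h'.1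
  | unionR _ ih => exact fun h h' => ih h.union_right h'.2
  | mu _ ih =>
    exact fun h h' => ih h.unfold
      ((SpineData.instAt_iff (h.sorted.mu_data_iff.trans h.sorted.data_iff) _ 0).2 h')
  | _ => exact fun _ h => h

/-- Subtypes of datatypes are datatypes. -/
theorem SubMu.isDatatype {A D : PreTy} (h : SubMu [] A D) (hD : IsDatatype D) : IsDatatype A := by
  refine (HasSort.data_iff h.wf.1.sorted).2 (.of_comp h.wf.1 fun C hC => ?_)
  obtain ⟨C', h1, h2⟩ := h.compSim C hC
  have := SpineData.comp h1 h.wf.2 ((HasSort.data_iff h.wf.2.sorted).1 hD)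
  cases h2 with
  | @fvar X Y h =>
    -- Without assumptions, a variable is matched only with itself.
    have e : X = Y := by
      induction h with
      | refl => rfl
      | tail _ h _ => cases h
    rwa [e]
  | const c => trivial
  | app => trivial
  | fn => exact this.elim

/-- A union is equivalent to a recursive type whose bound variable does not occur. -/
theorem EqMu.exists_not_isUnion {A : PreTy} (h : WF A) : ∃ A', EqMu A A' ∧ ¬ A'.IsUnion := by
  by_cases hA : A.IsUnion
  · obtain ⟨k, hk⟩ : ∃ k, HasSort .type (mu k A) := by
      by_cases hd : HasSort .data A
      · exact ⟨.data, hd⟩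
      · exact ⟨.type, h.sorted, hd⟩
    have hw : WF (mu k A) := ⟨h.closed.of_zero _, hk, Guarded.of_closedAt h.closed le_rfl,
      h.contractive⟩
    have := EqMu.fold hw
    rw [inst_of_closed h.closed] at this
    exact ⟨_, this.symm, fun h => h⟩
  · exact ⟨A, .refl h, hA⟩

/-! ### Typing -/

theorem PatHasType.wf {θ : Ctx} {p : PrePattern} {A : PreTy} (h : PatHasType θ p A) : WF A := by
  induction h with
  | @matchable x A _ => exact A.2
  | const c => exact WF.const c
  | comp hD _ _ ih1 ih2 => exact ih1.app hD ih2

theorem HasType.wf {Γ : Ctx} {s : Term} {A : PreTy} (h : HasType Γ s A) : WF A := by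
  induction h with
  | @var Γ x A _ => exact A.2
  | const c => exact WF.const c
  | comp hD _ _ ih1 ih2 => exact ih1.app hD ih2
  | abs _ hp _ _ ih => exact (WF.bigUnion fun i => (hp i).wf).fn (ih 0)
  | app _ _ _ ih1 _ => exact ih1.fn_right
  | subs _ h _ => exact h.wf.2

/-- The missing subsumptions are reinserted: branches are raised to the union of their types, and
the operator to a single arrow from the type of the argument. -/
theorem SDHasType.toHasType {Γ : Ctx} {s : Term} {A : PreTy} (h : SDHasType Γ s A) :
    HasType Γ s A := by
  induction h with
  | var h => exact .var h
  | const c => exact .const c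
  | comp hD _ _ ih1 ih2 => exact .comp hD ih1 ih2
  | abs hc hp hd _ ih =>
    exact .abs hc hp hd fun i => .subs (ih i) (SubMu.le_bigUnion (fun i => (ih i).wf) i)
  | @app Γ r u A C n A' B' _ he _ _ hs ih1 ih2 =>
    have hw : ∀ i, WF (B' i) := fun i => (he.wf.2.of_bigUnion i).fn_right
    have hle : SubMu [] A (.fn C (bigUnion B')) :=
      .trans (.eq he) (.bigUnion_le fun i => .func (hs i) (.le_bigUnion hw i))
    -- The domain is taken as a union with the single member `C`.
    exact .app (n := 0) (A := fun _ => C) 0 (.subs ih1 hle) ih2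

theorem HasType.exists_sdHasType {Γ : Ctx} {s : Term} {A : PreTy} (h : HasType Γ s A) :
    ∃ A', SubMu [] A' A ∧ SDHasType Γ s A' := by
  induction h with
  | @var Γ x A h => exact ⟨_, .refl A.2, .var h⟩
  | const c => exact ⟨_, .refl (WF.const c), .const c⟩
  | comp hD _ _ ih1 ih2 =>
    obtain ⟨D', h1, h1'⟩ := ih1
    obtain ⟨A', h2, h2'⟩ := ih2
    have hD' := h1.isDatatype hD
    exact ⟨_, .comp hD' hD h1 h2, .comp hD' h1' h2'⟩
  | abs hc hp hd _ ih =>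
    choose B' hB' ih using ih
    exact ⟨_, .func (.refl (WF.bigUnion fun i => (hp i).wf)) (.bigUnion_le hB'),
      .abs hc hp hd ih⟩
  | @app Γ r u n A B k hr _ ih1 ih2 =>
    obtain ⟨R, h1, h1'⟩ := ih1
    obtain ⟨U, h2, h2'⟩ := ih2
    obtain ⟨m, P, Q, he, hPQ⟩ := h1.fn_inversion
    -- The domains found by inversion may be unions; they are exchanged for equivalent non-unions,
    -- as the algorithmic rule demands.
    choose P' hP' hu using fun i => EqMu.exists_not_isUnion (hPQ i).1.wf.2
    have hU : SubMu [] U (bigUnion A) :=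
      .trans h2 (.le_bigUnion (fun i => hr.wf.fn_left.of_bigUnion i) k)
    exact ⟨_, .bigUnion_le fun i => (hPQ i).2,
      .app h1' (.trans he (.bigUnion fun i => .func (hP' i) (.refl (hPQ i).2.wf.1))) hu h2'
        fun i => .trans (.trans hU (hPQ i).1) (.eq (hP' i))⟩
  | subs _ h ih =>
    obtain ⟨A', h1, h1'⟩ := ih
    exact ⟨A', .trans h1 h, h1'⟩

end CAP

theorem mainTheorem3 (Γ : CAP.Ctx) (s : CAP.Term) :
    (∀ A : CAP.MuType, CAP.SDHasType Γ s A.1 → CAP.HasType Γ s A.1) ∧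
    (∀ A : CAP.MuType, CAP.HasType Γ s A.1 →
      ∃ A' : CAP.MuType, CAP.SubMu [] A'.1 A.1 ∧ CAP.SDHasType Γ s A'.1) := by
  refine ⟨fun A h => h.toHasType, fun A h => ?_⟩
  obtain ⟨A', h1, h2⟩ := h.exists_sdHasType
  exact ⟨⟨A', h1.wf.1⟩, h1, h2⟩
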